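/- Let $A$ and $G$ be sets of agents and goods with $|A|=|G|=n\ge 1$, and let $u_{ij}\ge 0$ $(i\in A,\ j\in G)$ be utilities with $\max_{j\in G}u_{ij}=1$ and $\sum_{j\in G}u_{ij}\ge 1/\kappa$ for every $i\in A$, where $\kappa>0$. Let $$P=\Bigl\{x\in\mathbb R_{\ge 0}^{A\times G} : \sum_{i\in A}x_{ij}\le 1\ \ \forall j\in G,\quad \sum_{j\in G}x_{ij}\le 1\ \ \forall i\in A\Bigr\}$$ be the bipartite matching polytope, $u_i(x)=\sum_{j\in G}u_{ij}x_{ij}$, and $$\psi(x)=\sum_{i\in A}\eta\Bigl(u_i(x);\tfrac1{2\kappa n}\Bigr),\qquad \eta(z;z_0)=\begin{cases}\log z_0+\frac{z-z_0}{z_0}-\frac{(z-z_0)^2}{2z_0^2}&\text{if } z\le z_0,\\ \log z&\text{if } z>z_0.\end{cases}$$ Consider the conditional gradient (Frank–Wolfe) algorithm that starts from $x^{(0)}=0$ and, for $t=1,\dots,T$, computes the weights $w^{(t)}_{ij}=\partial_{ij}\psi(x^{(t-1)})$, takes $y^{(t)}$ to be (the incidence matrix of) any maximum-weight matching of the complete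 bipartite graph on $A\cup G$ with weights $w^{(t)}$, sets $$x^{(t)}=\Bigl(1-\frac2{t+1}\Bigr)x^{(t-1)}+\frac2{t+1}\,y^{(t)},$$ and finally returns $x^{(T)}$. Then $\psi$ attains its maximum over $P$, and there is an absolute constant $C>0$ such that for every such instance, every maximizer $x^*$ of $\psi$ over $P$, every $\varepsilon>0$ and every integer $T\ge C\,n^3\kappa^2/\varepsilon$, the returned point $x^{(T)}$ lies in $P$ and satisfies $\psi(x^*)-\psi(x^{(T)})\le\varepsilon$; that is, $O(n^3\kappa^2/\varepsilon)$ iterations suffice. Moreover, each iteration can be implemented in $O(n^3)$ time: there is a single program for a real random access machine (unit-cost arithmetic and comparisons on real numbers, unit-cost additions, subtractions and comparisons on natural numbers, unit-cost indexed array access) that, given $n,\kappa,u,t$ and $x^{(t-1)}$, computes an $x^{(t)}$ as above in $O(n^3)$ steps, with an absolute implied constant. -/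

import Mathlib

/-! ## The market, the modified program and the conditional gradient algorithm -/

namespace LiF

/-- An allocation of `n` goods to `n` agents: `x i j` is the amount of good `j` given to agent `i`. -/
abbrev Alloc (n : ℕ) : Type := Fin n → Fin n → ℝ

/-- Utility matrices `u` (agent `i`, good `j`) that are non-negative, rescaled so that
`max_j u i j = 1` for every agent `i`, and satisfy `∑ j, u i j ≥ 1 / κ`. -/
structure IsInstance {n : ℕ} (κ : ℝ) (u : Fin n → Fin n → ℝ) : Prop where
  kappa_pos : 0 < κ
  nonneg : ∀ i j, 0 ≤ u i j
  max_eq_one : ∀ i, IsGreatest (Set.range (u i)) 1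
  sum_ge : ∀ i, 1 / κ ≤ ∑ j, u i j

/-- The utility `u_i(x) = ∑_j u_ij x_ij` of agent `i`. -/
def utility {n : ℕ} (u : Fin n → Fin n → ℝ) (x : Alloc n) (i : Fin n) : ℝ :=
  ∑ j, u i j * x i j

/-- The (fractional) bipartite matching polytope. -/
def matchingPolytope (n : ℕ) : Set (Alloc n) :=
  {x | (∀ j, ∑ i, x i j ≤ 1) ∧ (∀ i, ∑ j, x i j ≤ 1) ∧ ∀ i j, 0 ≤ x i j}

/-- The quadratic extension of the logarithm at `x₀`. -/
noncomputable def eta (x x₀ : ℝ) : ℝ :=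
  if x ≤ x₀ then Real.log x₀ + (x - x₀) * (1 / x₀) - 1 / 2 * (x - x₀) ^ 2 * (1 / x₀ ^ 2)
  else Real.log x

/-- The modified objective `ψ(x) = ∑_i η(u_i(x); 1 / (2 κ n))`. -/
noncomputable def psi {n : ℕ} (κ : ℝ) (u : Fin n → Fin n → ℝ) (x : Alloc n) : ℝ :=
  ∑ i, eta (utility u x i) (1 / (2 * κ * (n : ℝ)))

/-- `x` is an optimal solution of the program: maximize `ψ` over the matching polytope. -/
def IsOptimal {n : ℕ} (κ : ℝ) (u : Fin n → Fin n → ℝ) (x : Alloc n) : Prop :=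
  x ∈ matchingPolytope n ∧ IsMaxOn (psi κ u) (matchingPolytope n) x

/-- The partial derivative `∂_ij ψ(x)`. -/
noncomputable def gradPsi {n : ℕ} (κ : ℝ) (u : Fin n → Fin n → ℝ) (x : Alloc n) :
    Fin n → Fin n → ℝ :=
  fun i j => lineDeriv ℝ (psi κ u) x (Pi.single i (Pi.single j 1))

/-- `y` is the incidence matrix of a matching in the complete bipartite graph on agents and goods. -/
def IsMatching {n : ℕ} (y : Alloc n) : Prop :=
  (∀ i j, y i j = 0 ∨ y i j = 1) ∧ (∀ j, ∑ i, y i j ≤ 1) ∧ ∀ i, ∑ j, y i j ≤ 1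

/-- `y` is the incidence matrix of a matching of maximum total weight with respect to `w`. -/
def IsMaxWeightMatching {n : ℕ} (w : Fin n → Fin n → ℝ) (y : Alloc n) : Prop :=
  IsMatching y ∧ ∀ z : Alloc n, IsMatching z → ∑ i, ∑ j, w i j * z i j ≤ ∑ i, ∑ j, w i j * y i j

/-- `x'` is a possible result of the `t`-th iteration (`t ≥ 1`) of the conditional gradient algorithm
from the iterate `x`; any maximum weight matching may be used. -/
def IsStep {n : ℕ} (κ : ℝ) (u : Fin n → Fin n → ℝ) (t : ℕ) (x x' : Alloc n) : Prop :=
  ∃ y : Alloc n, IsMaxWeightMatching (gradPsi κ u x) y ∧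
    x' = (1 - 2 / ((t : ℝ) + 1)) • x + (2 / ((t : ℝ) + 1)) • y

/-- `x 0, …, x T` are the iterates of a run of `T` iterations of the conditional gradient algorithm;
the run returns `x T`. -/
def IsRun {n : ℕ} (κ : ℝ) (u : Fin n → Fin n → ℝ) (T : ℕ) (x : ℕ → Alloc n) : Prop :=
  x 0 = 0 ∧ ∀ t : ℕ, 1 ≤ t → t ≤ T → IsStep κ u t (x (t - 1)) (x t)

end LiF

/-! ## A real random access machine with unit-cost operations

Programs are finite texts of an imperative language. The memory holds natural numbers (used for
counters and indices) and real numbers, in scalar variables and in arrays whose entries are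
addressed by a row and a column index. Every arithmetic operation, comparison, memory access,
assignment and test has cost one. There is no conversion from reals to natural numbers. -/

namespace RealRAM

/-- The memory: scalar variables and two-dimensional arrays, named by natural numbers. -/
structure State where
  ivar : ℕ → ℕ
  rvar : ℕ → ℝ
  iarr : ℕ → ℕ → ℕ → ℕ
  rarr : ℕ → ℕ → ℕ → ℝ

/-- Expressions of natural-number type (subtraction is truncated). -/
inductive IExpr where
  | const (k : ℕ)
  | var (v : ℕ)
  | get (a : ℕ) (row col : IExpr)
  | add (e₁ e₂ : IExpr)
  | sub (e₁ e₂ : IExpr)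

/-- Expressions of real type (division by zero returns zero). -/
inductive RExpr where
  | ofNat (e : IExpr)
  | var (v : ℕ)
  | get (a : ℕ) (row col : IExpr)
  | add (e₁ e₂ : RExpr)
  | sub (e₁ e₂ : RExpr)
  | mul (e₁ e₂ : RExpr)
  | div (e₁ e₂ : RExpr)

/-- Tests. -/
inductive BExpr where
  | ile (e₁ e₂ : IExpr)
  | rle (e₁ e₂ : RExpr)
  | not (b : BExpr)
  | and (b₁ b₂ : BExpr)

/-- Programs. -/
inductive Cmd where
  | skip
  | iset (v : ℕ) (e : IExpr)
  | rset (v : ℕ) (e : RExpr)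
  | iput (a : ℕ) (row col : IExpr) (e : IExpr)
  | rput (a : ℕ) (row col : IExpr) (e : RExpr)
  | seq (c₁ c₂ : Cmd)
  | ite (b : BExpr) (c₁ c₂ : Cmd)
  | loop (b : BExpr) (c : Cmd)

def IExpr.eval (s : State) : IExpr → ℕ
  | .const k => k
  | .var v => s.ivar v
  | .get a row col => s.iarr a (row.eval s) (col.eval s)
  | .add e₁ e₂ => e₁.eval s + e₂.eval s
  | .sub e₁ e₂ => e₁.eval s - e₂.eval s

def IExpr.cost : IExpr → ℕ
  | .const _ => 1
  | .var _ => 1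
  | .get _ row col => row.cost + col.cost + 1
  | .add e₁ e₂ => e₁.cost + e₂.cost + 1
  | .sub e₁ e₂ => e₁.cost + e₂.cost + 1

noncomputable def RExpr.eval (s : State) : RExpr → ℝ
  | .ofNat e => (e.eval s : ℝ)
  | .var v => s.rvar v
  | .get a row col => s.rarr a (row.eval s) (col.eval s)
  | .add e₁ e₂ => e₁.eval s + e₂.eval s
  | .sub e₁ e₂ => e₁.eval s - e₂.eval s
  | .mul e₁ e₂ => e₁.eval s * e₂.eval s
  | .div e₁ e₂ => e₁.eval s / e₂.eval s

def RExpr.cost : RExpr → ℕ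
  | .ofNat e => e.cost + 1
  | .var _ => 1
  | .get _ row col => row.cost + col.cost + 1
  | .add e₁ e₂ => e₁.cost + e₂.cost + 1
  | .sub e₁ e₂ => e₁.cost + e₂.cost + 1
  | .mul e₁ e₂ => e₁.cost + e₂.cost + 1
  | .div e₁ e₂ => e₁.cost + e₂.cost + 1

def BExpr.holds (s : State) : BExpr → Prop
  | .ile e₁ e₂ => e₁.eval s ≤ e₂.eval s
  | .rle e₁ e₂ => e₁.eval s ≤ e₂.eval s
  | .not b => ¬ b.holds s
  | .and b₁ b₂ => b₁.holds s ∧ b₂.holds s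

def BExpr.cost : BExpr → ℕ
  | .ile e₁ e₂ => e₁.cost + e₂.cost + 1
  | .rle e₁ e₂ => e₁.cost + e₂.cost + 1
  | .not b => b.cost + 1
  | .and b₁ b₂ => b₁.cost + b₂.cost + 1

def State.setI (s : State) (v k : ℕ) : State :=
  { s with ivar := Function.update s.ivar v k }

noncomputable def State.setR (s : State) (v : ℕ) (r : ℝ) : State :=
  { s with rvar := Function.update s.rvar v r }

def State.putI (s : State) (a row col k : ℕ) : State :=
  let newRow := Function.update (s.iarr a row) col k
  { s with iarr := Function.update s.iarr a (Function.update (s.iarr a) row newRow) }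

noncomputable def State.putR (s : State) (a row col : ℕ) (r : ℝ) : State :=
  let newRow := Function.update (s.rarr a row) col r
  { s with rarr := Function.update s.rarr a (Function.update (s.rarr a) row newRow) }

/-- `Exec c s s' k`: started in the memory `s`, the program `c` halts in the memory `s'`, and the
total cost of the operations that it performs is `k`. -/
inductive Exec : Cmd → State → State → ℕ → Prop
  | skip (s : State) : Exec .skip s s 1
  | iset (s : State) (v : ℕ) (e : IExpr) :
      Exec (.iset v e) s (s.setI v (e.eval s)) (e.cost + 1)
  | rset (s : State) (v : ℕ) (e : RExpr) :
      Exec (.rset v e) s (s.setR v (e.eval s)) (e.cost + 1)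
  | iput (s : State) (a : ℕ) (row col : IExpr) (e : IExpr) :
      Exec (.iput a row col e) s (s.putI a (row.eval s) (col.eval s) (e.eval s))
        (row.cost + col.cost + e.cost + 1)
  | rput (s : State) (a : ℕ) (row col : IExpr) (e : RExpr) :
      Exec (.rput a row col e) s (s.putR a (row.eval s) (col.eval s) (e.eval s))
        (row.cost + col.cost + e.cost + 1)
  | seq {c₁ c₂ : Cmd} {s s₁ s₂ : State} {k₁ k₂ : ℕ} :
      Exec c₁ s s₁ k₁ → Exec c₂ s₁ s₂ k₂ → Exec (.seq c₁ c₂) s s₂ (k₁ + k₂)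
  | ite_true {b : BExpr} {c₁ c₂ : Cmd} {s s' : State} {k : ℕ} :
      b.holds s → Exec c₁ s s' k → Exec (.ite b c₁ c₂) s s' (b.cost + 1 + k)
  | ite_false {b : BExpr} {c₁ c₂ : Cmd} {s s' : State} {k : ℕ} :
      ¬ b.holds s → Exec c₂ s s' k → Exec (.ite b c₁ c₂) s s' (b.cost + 1 + k)
  | loop_false {b : BExpr} {c : Cmd} {s : State} :
      ¬ b.holds s → Exec (.loop b c) s s (b.cost + 1)
  | loop_true {b : BExpr} {c : Cmd} {s s₁ s₂ : State} {k₁ k₂ : ℕ} :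
      b.holds s → Exec c s s₁ k₁ → Exec (.loop b c) s₁ s₂ k₂ →
        Exec (.loop b c) s s₂ (b.cost + 1 + k₁ + k₂)

end RealRAM

namespace LiF

/-- The memory `s` holds the size `n`, the iteration counter `t`, the parameter `κ`, the utilities `u`
and the current iterate `x` in fixed places; the rest of the memory is arbitrary. -/
def Stores (s : RealRAM.State) {n : ℕ} (t : ℕ) (κ : ℝ) (u : Fin n → Fin n → ℝ) (x : Alloc n) : Prop :=
  s.ivar 0 = n ∧ s.ivar 1 = t ∧ s.rvar 0 = κ ∧
    (∀ i j : Fin n, s.rarr 0 i j = u i j) ∧ ∀ i j : Fin n, s.rarr 1 i j = x i j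

end LiF

/-!
For the iteration bound: `η(·; z₀)` is concave and `1 / z₀²`-smooth, and all utilities stay in
`[0, 1]` on the polytope. So `ψ` loses at most `2 κ² n³ c²` against its linearisation along a step
of length `c` between points of the polytope. The Frank–Wolfe recurrence then gives the gap
`8 κ² n³ / (t + 1)` after `t` iterations. By Birkhoff's theorem a matching of maximum weight
maximises the linearisation over the whole polytope.

For the running time: the gradient of `ψ` has the closed form `∂ᵢⱼ ψ(x) = η'(uᵢ(x)) uᵢⱼ ≥ 0`, and a
matching of maximum weight for nonnegative weights is found in `O(n³)` steps by the Hungarian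
method, which inserts the agents one at a time. An insertion grows a tree of alternating paths by
Dijkstra's algorithm on the slacks of a feasible dual solution, at a cost of `O(n)` per vertex.
-/

namespace LiF

/-! ### The quadratic extension of the logarithm -/

theorem hasDerivAt_ite_le {f g : ℝ → ℝ} {d a : ℝ} (hf : HasDerivAt f d a) (hg : HasDerivAt g d a)
    (hfg : f a = g a) : HasDerivAt (fun x => if x ≤ a then f x else g x) d a := by
  rw [← hasDerivWithinAt_univ, ← Set.Iic_union_Ici (a := a)]
  refine HasDerivWithinAt.union ?_ ?_
  · exact hf.hasDerivWithinAt.congr (fun x hx => if_pos hx) (if_pos le_rfl)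
  · refine hg.hasDerivWithinAt.congr (fun x hx => ?_) (by simp [hfg])
    rcases eq_or_lt_of_le (show a ≤ x from hx) with rfl | hax
    · simp [hfg]
    · exact if_neg hax.not_ge

theorem tangent_le_of_convexOn {f : ℝ → ℝ} {f' x : ℝ} (hf : ConvexOn ℝ Set.univ f)
    (hx : HasDerivAt f f' x) (y : ℝ) : f x + f' * (y - x) ≤ f y := by
  rcases lt_trichotomy x y with hxy | rfl | hxy
  · have := hf.le_slope_of_hasDerivAt (Set.mem_univ x) (Set.mem_univ y) hxy hx
    rw [slope_def_field, le_div_iff₀ (by linarith)] at this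
    linarith
  · simp
  · have := hf.slope_le_of_hasDerivAt (Set.mem_univ y) (Set.mem_univ x) hxy hx
    rw [slope_def_field, div_le_iff₀ (by linarith)] at this
    linarith

theorem tangent_le_of_monotone_deriv {f f' : ℝ → ℝ} (hf : ∀ x, HasDerivAt f (f' x) x)
    (hf' : Monotone f') (x y : ℝ) : f x + f' x * (y - x) ≤ f y :=
  have hderiv : deriv f = f' := funext fun z => (hf z).deriv
  tangent_le_of_convexOn
    (Monotone.convexOn_univ_of_deriv (fun z => (hf z).differentiableAt) (hderiv ▸ hf')) (hf x) y

/-- The derivative of `fun z => eta z z₀`. -/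
noncomputable def etaDeriv (z z₀ : ℝ) : ℝ :=
  if z ≤ z₀ then 2 / z₀ - z / z₀ ^ 2 else 1 / z

theorem hasDerivAt_quadratic_log {z₀ : ℝ} (hz₀ : z₀ ≠ 0) (z : ℝ) :
    HasDerivAt
      (fun x => Real.log z₀ + (x - z₀) * (1 / z₀) - 1 / 2 * (x - z₀) ^ 2 * (1 / z₀ ^ 2))
      (2 / z₀ - z / z₀ ^ 2) z := by
  have hsub : HasDerivAt (fun x : ℝ => x - z₀) 1 z := (hasDerivAt_id z).sub_const z₀
  refine (((hsub.mul_const (1 / z₀)).const_add (Real.log z₀)).sub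
    (((hsub.pow 2).const_mul (1 / 2)).mul_const (1 / z₀ ^ 2))).congr_deriv ?_
  simp only [Nat.cast_ofNat]
  field_simp
  ring

theorem hasDerivAt_eta {z₀ : ℝ} (hz₀ : 0 < z₀) (z : ℝ) :
    HasDerivAt (fun z => eta z z₀) (etaDeriv z z₀) z := by
  rcases lt_trichotomy z z₀ with hz | rfl | hz
  · rw [etaDeriv, if_pos hz.le]
    refine (hasDerivAt_quadratic_log hz₀.ne' z).congr_of_eventuallyEq ?_
    filter_upwards [Iio_mem_nhds hz] with x hx
    exact if_pos (le_of_lt hx)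
  · have hlog : 2 / z - z / z ^ 2 = z⁻¹ := by field_simp; ring
    have hquad := hasDerivAt_quadratic_log hz₀.ne' z
    rw [etaDeriv, if_pos le_rfl, hlog]
    rw [hlog] at hquad
    exact hasDerivAt_ite_le hquad (Real.hasDerivAt_log hz₀.ne') (by ring)
  · rw [etaDeriv, if_neg hz.not_ge, one_div]
    refine (Real.hasDerivAt_log (hz₀.trans hz).ne').congr_of_eventuallyEq ?_
    filter_upwards [Ioi_mem_nhds hz] with x hx
    exact if_neg (not_le.2 hx)

theorem etaDeriv_nonneg {z₀ : ℝ} (hz₀ : 0 < z₀) (z : ℝ) : 0 ≤ etaDeriv z z₀ := by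
  unfold etaDeriv
  split_ifs with hz
  · have : 2 / z₀ - z / z₀ ^ 2 = (2 * z₀ - z) / z₀ ^ 2 := by field_simp
    rw [this]
    exact div_nonneg (by linarith) (sq_nonneg z₀)
  · exact one_div_nonneg.2 (hz₀.trans (not_le.1 hz)).le

theorem etaDeriv_antitone {z₀ : ℝ} (hz₀ : 0 < z₀) : Antitone (fun z => etaDeriv z z₀) := by
  intro y z hyz
  dsimp only [etaDeriv]
  split_ifs with hz hy hy
  · gcongr
  · linarith
  · calc 1 / z ≤ 1 / z₀ := one_div_le_one_div_of_le hz₀ (not_le.1 hz).le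
      _ ≤ 1 / z₀ + (z₀ - y) / z₀ ^ 2 :=
        le_add_of_nonneg_right (div_nonneg (by linarith) (sq_nonneg z₀))
      _ = 2 / z₀ - y / z₀ ^ 2 := by field_simp; ring
  · exact one_div_le_one_div_of_le (hz₀.trans (not_le.1 hy)) hyz

theorem one_div_add_div_sq_monotoneOn {z₀ : ℝ} (hz₀ : 0 < z₀) :
    MonotoneOn (fun z => 1 / z + z / z₀ ^ 2) (Set.Ici z₀) := by
  intro y hy z hz hyz
  have hy₀ : 0 < y := hz₀.trans_le hy
  have hz₁ : 0 < z := hz₀.trans_le hz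
  have hdiff : 1 / z + z / z₀ ^ 2 - (1 / y + y / z₀ ^ 2) =
      (z - y) * (y * z - z₀ ^ 2) / (y * z * z₀ ^ 2) := by
    field_simp
    ring
  have hmul : z₀ ^ 2 ≤ y * z := by
    rw [sq]
    exact mul_le_mul hy hz hz₀.le hy₀.le
  refine sub_nonneg.1 (hdiff ▸ ?_)
  exact div_nonneg (mul_nonneg (by linarith) (by linarith)) (by positivity)

theorem etaDeriv_add_monotone {z₀ : ℝ} (hz₀ : 0 < z₀) :
    Monotone (fun z => etaDeriv z z₀ + z / z₀ ^ 2) := by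
  intro y z hyz
  dsimp only [etaDeriv]
  split_ifs with hy hz hz
  · linarith
  · calc 2 / z₀ - y / z₀ ^ 2 + y / z₀ ^ 2 = 1 / z₀ + z₀ / z₀ ^ 2 := by field_simp; ring
      _ ≤ 1 / z + z / z₀ ^ 2 :=
        one_div_add_div_sq_monotoneOn hz₀ Set.self_mem_Ici (not_le.1 hz).le (not_le.1 hz).le
  · linarith
  · exact one_div_add_div_sq_monotoneOn hz₀ (not_le.1 hy).le (not_le.1 hz).le hyz

theorem eta_le_tangent {z₀ : ℝ} (hz₀ : 0 < z₀) (x y : ℝ) :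
    eta y z₀ ≤ eta x z₀ + etaDeriv x z₀ * (y - x) := by
  have := tangent_le_of_monotone_deriv (f := fun z => -eta z z₀) (f' := fun z => -etaDeriv z z₀)
    (fun z => (hasDerivAt_eta hz₀ z).neg) (etaDeriv_antitone hz₀).neg x y
  linarith

theorem tangent_sub_sq_le_eta {z₀ : ℝ} (hz₀ : 0 < z₀) (x y : ℝ) :
    eta x z₀ + etaDeriv x z₀ * (y - x) - (y - x) ^ 2 / (2 * z₀ ^ 2) ≤ eta y z₀ := by
  have htangent := tangent_le_of_monotone_deriv (f := fun z => eta z z₀ + z ^ 2 / (2 * z₀ ^ 2))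
    (f' := fun z => etaDeriv z z₀ + z / z₀ ^ 2)
    (fun z => ((hasDerivAt_eta hz₀ z).add (((hasDerivAt_id z).pow 2).div_const _)).congr_deriv
      (by simp; field_simp)) (etaDeriv_add_monotone hz₀) x y
  have hsq : (y - x) ^ 2 / (2 * z₀ ^ 2) = y ^ 2 / (2 * z₀ ^ 2) - x ^ 2 / (2 * z₀ ^ 2)
      - x / z₀ ^ 2 * (y - x) := by field_simp; ring
  linarith

/-! ### The conditional gradient method -/

section FrankWolfe

variable {E : Type*} [AddCommGroup E] [Module ℝ E] {S : Set E} {f : E → ℝ} {f' : E → E →ₗ[ℝ] ℝ}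
  {C : ℝ}

/-- `f` is concave on `S` with gradient `f'`, and its curvature constant in the sense of the
analysis of the conditional gradient method is at most `C`. -/
structure ConcaveWithCurvature (S : Set E) (f : E → ℝ) (f' : E → E →ₗ[ℝ] ℝ) (C : ℝ) : Prop where
  le_tangent : ∀ x ∈ S, ∀ y ∈ S, f y ≤ f x + f' x (y - x)
  tangent_sub_le : ∀ x ∈ S, ∀ y ∈ S, ∀ c ∈ Set.Icc (0 : ℝ) 1,
    f x + c * f' x (y - x) - C / 2 * c ^ 2 ≤ f (x + c • (y - x))

/-- A conditional gradient step of length `c` from `x` to `x'`: towards a point of `S` at which the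
linear function `f' x` is maximal. -/
def IsFrankWolfeStep (S : Set E) (f' : E → E →ₗ[ℝ] ℝ) (c : ℝ) (x x' : E) : Prop :=
  ∃ y ∈ S, IsMaxOn (f' x) S y ∧ x' = (1 - c) • x + c • y

theorem IsFrankWolfeStep.mem (hS : Convex ℝ S) {c : ℝ} (hc : c ∈ Set.Icc (0 : ℝ) 1) {x x' : E}
    (hstep : IsFrankWolfeStep S f' c x x') (hx : x ∈ S) : x' ∈ S := by
  obtain ⟨y, hy, -, rfl⟩ := hstep
  exact hS hx hy (sub_nonneg.2 hc.2) hc.1 (sub_add_cancel 1 c)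

theorem IsFrankWolfeStep.gap_le (hf : ConcaveWithCurvature S f f' C) {c : ℝ}
    (hc : c ∈ Set.Icc (0 : ℝ) 1) {x x' z : E} (hstep : IsFrankWolfeStep S f' c x x') (hx : x ∈ S)
    (hz : z ∈ S) : f z - f x' ≤ (1 - c) * (f z - f x) + C / 2 * c ^ 2 := by
  obtain ⟨y, hy, hmax, rfl⟩ := hstep
  have hprogress := hf.tangent_sub_le x hx y hy c hc
  have hgap : f z - f x ≤ f' x (y - x) := by
    have htangent := hf.le_tangent x hx z hz
    have : f' x z ≤ f' x y := hmax hz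
    rw [map_sub] at htangent ⊢
    linarith
  rw [show x + c • (y - x) = (1 - c) • x + c • y by module] at hprogress
  linarith [mul_le_mul_of_nonneg_left hgap hc.1]

theorem two_div_add_two_mem_Icc (t : ℕ) : 2 / ((t : ℝ) + 2) ∈ Set.Icc (0 : ℝ) 1 :=
  ⟨by positivity, (div_le_one (by positivity)).2 (by linarith [t.cast_nonneg (α := ℝ)])⟩

theorem le_div_of_frankWolfe_recurrence (hC : 0 ≤ C) {gap : ℕ → ℝ} {T : ℕ}
    (hgap : ∀ t < T, gap (t + 1) ≤
      (1 - 2 / ((t : ℝ) + 2)) * gap t + C / 2 * (2 / ((t : ℝ) + 2)) ^ 2) :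
    ∀ t < T, gap (t + 1) ≤ 2 * C / ((t : ℝ) + 2) := by
  intro t
  induction t with
  | zero =>
    intro hT
    have := hgap 0 hT
    norm_num at this ⊢
    linarith
  | succ t ih =>
    intro hT
    have hlength : 0 ≤ 1 - 2 / (((t + 1 : ℕ) : ℝ) + 2) :=
      sub_nonneg.2 (two_div_add_two_mem_Icc (t + 1)).2
    refine (hgap (t + 1) hT).trans ((add_le_add_left
      (mul_le_mul_of_nonneg_left (ih (by omega)) hlength) _).trans (sub_nonneg.1 ?_))
    have hslack : 2 * C / (((t + 1 : ℕ) : ℝ) + 2) -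
        ((1 - 2 / (((t + 1 : ℕ) : ℝ) + 2)) * (2 * C / ((t : ℝ) + 2)) +
          C / 2 * (2 / (((t + 1 : ℕ) : ℝ) + 2)) ^ 2) =
        2 * C / (((t : ℝ) + 2) * ((t : ℝ) + 3) ^ 2) := by
      push_cast
      field_simp
      ring
    rw [hslack]
    positivity

theorem frankWolfe_mem (hS : Convex ℝ S) {x : ℕ → E} {T : ℕ} (hx : x 0 ∈ S)
    (hstep : ∀ t < T, IsFrankWolfeStep S f' (2 / ((t : ℝ) + 2)) (x t) (x (t + 1))) :
    ∀ t ≤ T, x t ∈ S := by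
  intro t
  induction t with
  | zero => exact fun _ => hx
  | succ t ih => exact fun ht => (hstep t ht).mem hS (two_div_add_two_mem_Icc t) (ih (by omega))

theorem ConcaveWithCurvature.frankWolfe_gap_le (hf : ConcaveWithCurvature S f f' C) (hC : 0 ≤ C)
    (hS : Convex ℝ S) {x : ℕ → E} {T : ℕ} (hx : x 0 ∈ S)
    (hstep : ∀ t < T, IsFrankWolfeStep S f' (2 / ((t : ℝ) + 2)) (x t) (x (t + 1))) {z : E}
    (hz : z ∈ S) : ∀ t < T, f z - f (x (t + 1)) ≤ 2 * C / ((t : ℝ) + 2) :=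
  le_div_of_frankWolfe_recurrence (gap := fun t => f z - f (x t)) hC fun t ht =>
    (hstep t ht).gap_le hf (two_div_add_two_mem_Icc t) (frankWolfe_mem hS hx hstep t ht.le) hz

end FrankWolfe

/-! ### The objective and its gradient -/

variable {n : ℕ}

/-- The point `1 / (2 κ n)` at which the logarithm is extended quadratically in `psi`. -/
noncomputable abbrev threshold (n : ℕ) (κ : ℝ) : ℝ := 1 / (2 * κ * (n : ℝ))

theorem threshold_pos {κ : ℝ} (hκ : 0 < κ) (hn : 0 < n) : 0 < threshold n κ := by
  have : (0 : ℝ) < n := Nat.cast_pos.2 hn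
  positivity

/-- The linear function whose value at the incidence matrix of a matching is the total weight of
the matching with respect to `w`. -/
noncomputable def weight (w : Fin n → Fin n → ℝ) : Alloc n →ₗ[ℝ] ℝ :=
  ∑ i, ∑ j, w i j • LinearMap.proj j ∘ₗ (LinearMap.proj i : Alloc n →ₗ[ℝ] Fin n → ℝ)

theorem weight_apply (w : Fin n → Fin n → ℝ) (x : Alloc n) :
    weight w x = ∑ i, ∑ j, w i j * x i j := by
  simp [weight]

theorem utility_add_smul (u : Fin n → Fin n → ℝ) (x d : Alloc n) (c : ℝ) (i : Fin n) :
    utility u (x + c • d) i = utility u x i + c * utility u d i := by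
  simp only [utility, Pi.add_apply, Pi.smul_apply, smul_eq_mul, mul_add, Finset.sum_add_distrib,
    Finset.mul_sum, mul_left_comm]

theorem utility_sub (u : Fin n → Fin n → ℝ) (x y : Alloc n) (i : Fin n) :
    utility u (x - y) i = utility u x i - utility u y i := by
  simp [utility, mul_sub, Finset.sum_sub_distrib]

theorem utility_single (u : Fin n → Fin n → ℝ) (i j k : Fin n) :
    utility u (Pi.single i (Pi.single j 1)) k = if k = i then u i j else 0 := by
  split_ifs with hk
  · subst hk; simp [utility, Pi.single_apply]
  · simp [utility, hk]

theorem utility_mem_Icc {u : Fin n → Fin n → ℝ} (hu : u ∈ Set.Icc 0 1) {x : Alloc n}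
    (hx : x ∈ matchingPolytope n) (i : Fin n) : utility u x i ∈ Set.Icc (0 : ℝ) 1 :=
  ⟨Finset.sum_nonneg fun j _ => mul_nonneg (hu.1 i j) (hx.2.2 i j),
    (Finset.sum_le_sum fun j _ => mul_le_of_le_one_left (hx.2.2 i j) (hu.2 i j)).trans (hx.2.1 i)⟩

theorem hasLineDerivAt_psi {κ : ℝ} (hz₀ : 0 < threshold n κ) (u : Fin n → Fin n → ℝ)
    (x d : Alloc n) :
    HasLineDerivAt ℝ (psi κ u)
      (∑ i, etaDeriv (utility u x i) (threshold n κ) * utility u d i) x d := by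
  refine HasDerivAt.fun_sum fun i _ => ?_
  simp only [utility_add_smul]
  have hline : HasDerivAt (fun c : ℝ => utility u x i + c * utility u d i) (utility u d i) 0 := by
    simpa using ((hasDerivAt_id (0 : ℝ)).mul_const (utility u d i)).const_add (utility u x i)
  simpa [Function.comp_def] using
    HasDerivAt.comp (0 : ℝ) (hasDerivAt_eta hz₀ (utility u x i + 0 * utility u d i)) hline

theorem gradPsi_eq {κ : ℝ} (hz₀ : 0 < threshold n κ) (u : Fin n → Fin n → ℝ) (x : Alloc n)
    (i j : Fin n) :
    gradPsi κ u x i j = etaDeriv (utility u x i) (threshold n κ) * u i j := by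
  rw [gradPsi, (hasLineDerivAt_psi hz₀ u x _).lineDeriv]
  simp [utility_single]

theorem gradPsi_nonneg {κ : ℝ} (hz₀ : 0 < threshold n κ) {u : Fin n → Fin n → ℝ} (hu : 0 ≤ u)
    (x : Alloc n) : 0 ≤ gradPsi κ u x := fun i j => by
  rw [gradPsi_eq hz₀]
  exact mul_nonneg (etaDeriv_nonneg hz₀ _) (hu i j)

theorem weight_gradPsi {κ : ℝ} (hz₀ : 0 < threshold n κ) (u : Fin n → Fin n → ℝ)
    (x d : Alloc n) :
    weight (gradPsi κ u x) d =
      ∑ i, etaDeriv (utility u x i) (threshold n κ) * utility u d i := by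
  simp only [weight_apply, gradPsi_eq hz₀, utility, Finset.mul_sum, mul_assoc]

theorem psi_le_tangent {κ : ℝ} (hz₀ : 0 < threshold n κ) (u : Fin n → Fin n → ℝ)
    (x y : Alloc n) : psi κ u y ≤ psi κ u x + weight (gradPsi κ u x) (y - x) := by
  rw [weight_gradPsi hz₀, psi, psi, ← Finset.sum_add_distrib]
  refine Finset.sum_le_sum fun i _ => ?_
  rw [utility_sub]
  exact eta_le_tangent hz₀ _ _

theorem tangent_sub_sq_le_psi {κ : ℝ} (hz₀ : 0 < threshold n κ) (u : Fin n → Fin n → ℝ)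
    (x d : Alloc n) (c : ℝ) :
    psi κ u x + c * weight (gradPsi κ u x) d -
        c ^ 2 / (2 * threshold n κ ^ 2) * ∑ i, utility u d i ^ 2 ≤ psi κ u (x + c • d) := by
  rw [weight_gradPsi hz₀, psi, psi, Finset.mul_sum, Finset.mul_sum, ← Finset.sum_add_distrib,
    ← Finset.sum_sub_distrib]
  refine Finset.sum_le_sum fun i _ => ?_
  rw [utility_add_smul]
  have := tangent_sub_sq_le_eta hz₀ (utility u x i) (utility u x i + c * utility u d i)
  rw [add_sub_cancel_left] at this
  exact (le_of_eq (by ring)).trans this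

theorem concaveWithCurvature_psi {κ : ℝ} (hz₀ : 0 < threshold n κ) {u : Fin n → Fin n → ℝ}
    (hu : u ∈ Set.Icc 0 1) :
    ConcaveWithCurvature (matchingPolytope n) (psi κ u) (fun x => weight (gradPsi κ u x))
      (4 * κ ^ 2 * n ^ 3) where
  le_tangent x _ y _ := psi_le_tangent hz₀ u x y
  tangent_sub_le x hx y hy c _ := by
    refine le_trans (sub_le_sub_left ?_ _) (tangent_sub_sq_le_psi hz₀ u x (y - x) c)
    have hdist : ∀ i, utility u (y - x) i ^ 2 ≤ 1 := fun i => by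
      obtain ⟨hx0, hx1⟩ := utility_mem_Icc hu hx i
      obtain ⟨hy0, hy1⟩ := utility_mem_Icc hu hy i
      rw [utility_sub, sq_le_one_iff_abs_le_one, abs_le]
      constructor <;> linarith
    have hsum : ∑ i, utility u (y - x) i ^ 2 ≤ n := by
      simpa using Finset.sum_le_sum fun i (_ : i ∈ Finset.univ) => hdist i
    calc c ^ 2 / (2 * threshold n κ ^ 2) * ∑ i, utility u (y - x) i ^ 2
        ≤ c ^ 2 / (2 * threshold n κ ^ 2) * n := by gcongr
      _ = 4 * κ ^ 2 * n ^ 3 / 2 * c ^ 2 := by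
        rw [threshold, one_div, inv_pow, ← div_div, div_inv_eq_mul]
        ring

theorem continuous_psi {κ : ℝ} (hz₀ : 0 < threshold n κ) (u : Fin n → Fin n → ℝ) :
    Continuous (psi κ u) := by
  have heta : Continuous fun z => eta z (threshold n κ) :=
    continuous_iff_continuousAt.2 fun z => (hasDerivAt_eta hz₀ z).continuousAt
  refine continuous_finsetSum _ fun i _ => heta.comp ?_
  unfold utility
  fun_prop

/-! ### The matching polytope -/

theorem isClosed_matchingPolytope (n : ℕ) : IsClosed (matchingPolytope n) := by
  simp only [matchingPolytope, Set.ofPred_and, Set.ofPred_forall]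
  refine (isClosed_iInter fun j => ?_).inter ((isClosed_iInter fun i => ?_).inter
    (isClosed_iInter fun i => isClosed_iInter fun j => ?_))
  · exact isClosed_le (by fun_prop) continuous_const
  · exact isClosed_le (by fun_prop) continuous_const
  · exact isClosed_le continuous_const (by fun_prop)

theorem isCompact_matchingPolytope (n : ℕ) : IsCompact (matchingPolytope n) :=
  isCompact_Icc.of_isClosed_subset (isClosed_matchingPolytope n) (s := Set.Icc 0 1)
    fun _ hx => ⟨hx.2.2, fun i j =>
      (Finset.single_le_sum (fun j _ => hx.2.2 i j) (Finset.mem_univ j)).trans (hx.2.1 i)⟩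

theorem convex_matchingPolytope (n : ℕ) : Convex ℝ (matchingPolytope n) := by
  intro x hx y hy a b ha hb hab
  refine ⟨fun j => ?_, fun i => ?_, fun i j => ?_⟩
  · simp only [Pi.add_apply, Pi.smul_apply, smul_eq_mul, Finset.sum_add_distrib, ← Finset.mul_sum]
    nlinarith [hx.1 j, hy.1 j]
  · simp only [Pi.add_apply, Pi.smul_apply, smul_eq_mul, Finset.sum_add_distrib, ← Finset.mul_sum]
    nlinarith [hx.2.1 i, hy.2.1 i]
  · exact add_nonneg (mul_nonneg ha (hx.2.2 i j)) (mul_nonneg hb (hy.2.2 i j))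

theorem zero_mem_matchingPolytope (n : ℕ) : (0 : Alloc n) ∈ matchingPolytope n := by
  simp [matchingPolytope]

theorem IsMatching.mem_matchingPolytope {y : Alloc n} (hy : IsMatching y) :
    y ∈ matchingPolytope n := by
  refine ⟨hy.2.1, hy.2.2, fun i j => ?_⟩
  rcases hy.1 i j with h | h <;> simp [h]

theorem exists_isOptimal {κ : ℝ} (hz₀ : 0 < threshold n κ) (u : Fin n → Fin n → ℝ) :
    ∃ x, IsOptimal κ u x :=
  (isCompact_matchingPolytope n).exists_isMaxOn ⟨0, zero_mem_matchingPolytope n⟩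
    (continuous_psi hz₀ u).continuousOn

section Substochastic

variable {K ι : Type*} [Field K] [LinearOrder K] [IsStrictOrderedRing K] [Fintype ι]

theorem mul_sum_div_sum_cancel {f : ι → K} (hf : ∀ i, 0 ≤ f i) (i : ι) :
    f i * (∑ k, f k) / ∑ k, f k = f i := by
  rcases eq_or_ne (∑ k, f k) 0 with hsum | hsum
  · simp [(Finset.sum_eq_zero_iff_of_nonneg fun k _ => hf k).1 hsum i (Finset.mem_univ i)]
  · exact mul_div_cancel_right₀ _ hsum

/-- The row deficits `r` and the column deficits `c` have the same total `R`, so adding the rank one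
matrix `r cᵀ / R` makes all row and column sums equal to `1`. -/
theorem exists_doublyStochastic_ge [DecidableEq ι] {x : Matrix ι ι K} (hnonneg : ∀ i j, 0 ≤ x i j)
    (hrow : ∀ i, ∑ j, x i j ≤ 1) (hcol : ∀ j, ∑ i, x i j ≤ 1) :
    ∃ X ∈ doublyStochastic K ι, ∀ i j, x i j ≤ X i j := by
  set r : ι → K := fun i => 1 - ∑ j, x i j with hr
  set c : ι → K := fun j => 1 - ∑ i, x i j with hc
  have hr_nonneg : ∀ i, 0 ≤ r i := fun i => sub_nonneg.2 (hrow i)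
  have hc_nonneg : ∀ j, 0 ≤ c j := fun j => sub_nonneg.2 (hcol j)
  have hsum : ∑ j, c j = ∑ i, r i := by
    simp only [hr, hc, Finset.sum_sub_distrib]
    rw [Finset.sum_comm]
  have hcorrection : ∀ i j, 0 ≤ r i * c j / ∑ k, r k := fun i j =>
    div_nonneg (mul_nonneg (hr_nonneg i) (hc_nonneg j)) (Finset.sum_nonneg fun k _ => hr_nonneg k)
  refine ⟨Matrix.of fun i j => x i j + r i * c j / ∑ k, r k, ?_, fun i j =>
    le_add_of_nonneg_right (hcorrection i j)⟩
  rw [mem_doublyStochastic_iff_sum]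
  simp only [Matrix.of_apply, Finset.sum_add_distrib, ← Finset.sum_div, ← Finset.mul_sum,
    ← Finset.sum_mul]
  refine ⟨fun i j => add_nonneg (hnonneg i j) (hcorrection i j), fun i => ?_, fun j => ?_⟩
  · rw [hsum, mul_sum_div_sum_cancel hr_nonneg]
    exact add_sub_cancel _ _
  · rw [mul_comm, ← hsum, mul_sum_div_sum_cancel hc_nonneg]
    exact add_sub_cancel _ _

end Substochastic

/-- The incidence matrix of a perfect matching. -/
def permAlloc (σ : Equiv.Perm (Fin n)) : Alloc n := fun i j => if σ i = j then 1 else 0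

theorem isMatching_permAlloc (σ : Equiv.Perm (Fin n)) : IsMatching (permAlloc σ) := by
  refine ⟨fun i j => ?_, fun j => ?_, fun i => ?_⟩
  · by_cases h : σ i = j <;> simp [permAlloc, h]
  · simp [permAlloc, ← Equiv.eq_symm_apply]
  · simp [permAlloc]

theorem weight_permAlloc (w : Fin n → Fin n → ℝ) (σ : Equiv.Perm (Fin n)) :
    weight w (permAlloc σ) = ∑ i, w i (σ i) := by
  simp [weight_apply, permAlloc]

theorem weight_mono {w : Fin n → Fin n → ℝ} (hw : 0 ≤ w) : Monotone (weight w) := fun x y hxy => by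
  simp only [weight_apply]
  exact Finset.sum_le_sum fun i _ => Finset.sum_le_sum fun j _ =>
    mul_le_mul_of_nonneg_left (hxy i j) (hw i j)

theorem weight_le_of_perm {w : Fin n → Fin n → ℝ} (hw : 0 ≤ w) {M : ℝ}
    (hM : ∀ σ : Equiv.Perm (Fin n), ∑ i, w i (σ i) ≤ M) {x : Alloc n}
    (hx : x ∈ matchingPolytope n) : weight w x ≤ M := by
  obtain ⟨X, hX, hle⟩ := exists_doublyStochastic_ge (x := x) hx.2.2 hx.2.1 hx.1
  obtain ⟨c, hc_nonneg, hc_sum, rfl⟩ := exists_eq_sum_perm_of_mem_doublyStochastic hX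
  have hperm : (∑ σ, c σ • σ.permMatrix ℝ : Matrix (Fin n) (Fin n) ℝ) =
      (∑ σ, c σ • permAlloc σ : Alloc n) := by
    refine Finset.sum_congr rfl fun σ _ => ?_
    ext i j
    simp [permAlloc, Equiv.Perm.permMatrix, PEquiv.toMatrix_apply]
  calc weight w x ≤ weight w (∑ σ, c σ • permAlloc σ) := weight_mono hw (hperm ▸ hle)
    _ = ∑ σ, c σ * ∑ i, w i (σ i) := by simp [weight_permAlloc]
    _ ≤ ∑ σ, c σ * M := Finset.sum_le_sum fun σ _ => mul_le_mul_of_nonneg_left (hM σ) (hc_nonneg σ)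
    _ = M := by rw [← Finset.sum_mul, hc_sum, one_mul]

theorem IsMaxWeightMatching.isMaxOn {w : Fin n → Fin n → ℝ} (hw : 0 ≤ w) {y : Alloc n}
    (hy : IsMaxWeightMatching w y) : IsMaxOn (weight w) (matchingPolytope n) y := fun x hx => by
  refine weight_le_of_perm hw (fun σ => ?_) hx
  rw [← weight_permAlloc, weight_apply, weight_apply]
  exact hy.2 _ (isMatching_permAlloc σ)

theorem isMaxWeightMatching_of_dual {w : Fin n → Fin n → ℝ} (hw : 0 ≤ w) (a b : Fin n → ℝ)
    (hfeasible : ∀ i j, w i j ≤ a i + b j) (σ : Equiv.Perm (Fin n))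
    (htight : ∀ i, w i (σ i) = a i + b (σ i)) : IsMaxWeightMatching w (permAlloc σ) := by
  have hdual : ∀ τ : Equiv.Perm (Fin n), ∑ i, (a i + b (τ i)) = ∑ i, a i + ∑ j, b j := fun τ => by
    rw [Finset.sum_add_distrib, Equiv.sum_comp τ b]
  refine ⟨isMatching_permAlloc σ, fun z hz => ?_⟩
  rw [← weight_apply, ← weight_apply]
  refine weight_le_of_perm hw (fun τ => ?_) hz.mem_matchingPolytope
  calc ∑ i, w i (τ i) ≤ ∑ i, (a i + b (τ i)) := Finset.sum_le_sum fun i _ => hfeasible i _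
    _ = ∑ i, (a i + b (σ i)) := by rw [hdual, hdual]
    _ = weight w (permAlloc σ) := by
      rw [weight_permAlloc]
      exact Finset.sum_congr rfl fun i _ => (htight i).symm

/-! ### Convergence -/

theorem IsRun.isFrankWolfeStep {κ : ℝ} (hz₀ : 0 < threshold n κ) {u : Fin n → Fin n → ℝ}
    (hu : 0 ≤ u) {T : ℕ} {x : ℕ → Alloc n} (hrun : IsRun κ u T x) {t : ℕ} (ht : t < T) :
    IsFrankWolfeStep (matchingPolytope n) (fun x => weight (gradPsi κ u x)) (2 / ((t : ℝ) + 2))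
      (x t) (x (t + 1)) := by
  obtain ⟨y, hy, hx⟩ := hrun.2 (t + 1) (by omega) ht
  refine ⟨y, hy.1.mem_matchingPolytope, hy.isMaxOn (gradPsi_nonneg hz₀ hu _), ?_⟩
  simpa [add_assoc, one_add_one_eq_two] using hx

theorem IsRun.mem_and_gap_le {κ : ℝ} (hκ : 0 < κ) (hn : 0 < n) {u : Fin n → Fin n → ℝ}
    (hu : u ∈ Set.Icc 0 1) {T : ℕ} {x : ℕ → Alloc n} (hrun : IsRun κ u T x) {z : Alloc n}
    (hz : z ∈ matchingPolytope n) {ε : ℝ} (hε : 0 < ε)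
    (hT : 8 * ((n : ℝ) ^ 3 * κ ^ 2 / ε) ≤ (T : ℝ)) :
    x T ∈ matchingPolytope n ∧ psi κ u z - psi κ u (x T) ≤ ε := by
  have hz₀ := threshold_pos hκ hn
  have : (0 : ℝ) < n := Nat.cast_pos.2 hn
  have hbudget : 0 < 8 * ((n : ℝ) ^ 3 * κ ^ 2 / ε) := by positivity
  obtain ⟨t, rfl⟩ : ∃ t, T = t + 1 :=
    Nat.exists_eq_add_one.2 (by exact_mod_cast hbudget.trans_le hT)
  have hx₀ : x 0 ∈ matchingPolytope n := hrun.1 ▸ zero_mem_matchingPolytope n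
  have hstep := fun s (hs : s < t + 1) => hrun.isFrankWolfeStep hz₀ hu.1 hs
  refine ⟨frankWolfe_mem (convex_matchingPolytope n) hx₀ hstep _ le_rfl,
    ((concaveWithCurvature_psi hz₀ hu).frankWolfe_gap_le (by positivity)
      (convex_matchingPolytope n) hx₀ hstep hz t t.lt_succ_self).trans ?_⟩
  have hscale : 8 * ((n : ℝ) ^ 3 * κ ^ 2 / ε) = 2 * (4 * κ ^ 2 * n ^ 3) / ε := by ring
  rw [hscale, div_le_iff₀ hε] at hT
  rw [div_le_iff₀ (by positivity)]
  push_cast at hT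
  linarith

end LiF

namespace RealRAM

/-! ### Memory cells and frames -/

/-- The parts of the memory that an assignment can change: a scalar variable or a whole array. -/
inductive Loc where
  | ivar (v : ℕ)
  | rvar (v : ℕ)
  | iarr (a : ℕ)
  | rarr (a : ℕ)

/-- `s` and `s'` have the same contents at `l`. -/
def State.AgreeAt (s s' : State) : Loc → Prop
  | .ivar v => s'.ivar v = s.ivar v
  | .rvar v => s'.rvar v = s.rvar v
  | .iarr a => s'.iarr a = s.iarr a
  | .rarr a => s'.rarr a = s.rarr a

theorem State.AgreeAt.refl (s : State) (l : Loc) : s.AgreeAt s l := by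
  cases l <;> rfl

theorem State.AgreeAt.trans {s s' s'' : State} {l : Loc} (h : s.AgreeAt s' l)
    (h' : s'.AgreeAt s'' l) : s.AgreeAt s'' l := by
  cases l <;> exact Eq.trans h' h

/-- `c` contains no assignment to `l`. -/
def Cmd.keeps : Cmd → Loc → Bool
  | .iset v _, .ivar w => w != v
  | .rset v _, .rvar w => w != v
  | .iput a _ _ _, .iarr b => b != a
  | .rput a _ _ _, .rarr b => b != a
  | .seq c₁ c₂, l => c₁.keeps l && c₂.keeps l
  | .ite _ c₁ c₂, l => c₁.keeps l && c₂.keeps l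
  | .loop _ c, l => c.keeps l
  | _, _ => true

/-- `s'` agrees with `s` on all that `c` does not assign. -/
def Frame (c : Cmd) (s s' : State) : Prop :=
  ∀ l, c.keeps l = true → s.AgreeAt s' l

namespace Frame

variable {c c₁ c₂ : Cmd} {b : BExpr} {s s' s'' : State}

theorem ivar (h : Frame c s s') (v : ℕ) (hv : c.keeps (.ivar v) = true) :
    s'.ivar v = s.ivar v := h _ hv

theorem rvar (h : Frame c s s') (v : ℕ) (hv : c.keeps (.rvar v) = true) :
    s'.rvar v = s.rvar v := h _ hv

theorem iarr (h : Frame c s s') (a : ℕ) (ha : c.keeps (.iarr a) = true) :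
    s'.iarr a = s.iarr a := h _ ha

theorem rarr (h : Frame c s s') (a : ℕ) (ha : c.keeps (.rarr a) = true) :
    s'.rarr a = s.rarr a := h _ ha

theorem refl (c : Cmd) (s : State) : Frame c s s := fun l _ => .refl s l

theorem trans (h : Frame c s s') (h' : Frame c s' s'') : Frame c s s'' :=
  fun l hl => (h l hl).trans (h' l hl)

theorem seq_left (h : Frame c₁ s s') : Frame (.seq c₁ c₂) s s' :=
  fun l hl => h l (Bool.and_elim_left hl)

theorem seq_right (h : Frame c₂ s s') : Frame (.seq c₁ c₂) s s' :=
  fun l hl => h l (Bool.and_elim_right hl)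

theorem ite_left (h : Frame c₁ s s') : Frame (.ite b c₁ c₂) s s' :=
  fun l hl => h l (Bool.and_elim_left hl)

theorem ite_right (h : Frame c₂ s s') : Frame (.ite b c₁ c₂) s s' :=
  fun l hl => h l (Bool.and_elim_right hl)

theorem loop (h : Frame c s s') : Frame (.loop b c) s s' := h

end Frame

theorem Exec.frame {c : Cmd} {s s' : State} {k : ℕ} (h : Exec c s s' k) : Frame c s s' := by
  induction h with
  | skip s => exact .refl _ _
  | iset s v e => intro l hl; cases l <;> simp_all [Cmd.keeps, State.AgreeAt, State.setI]
  | rset s v e => intro l hl; cases l <;> simp_all [Cmd.keeps, State.AgreeAt, State.setR]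
  | iput s a r c e => intro l hl; cases l <;> simp_all [Cmd.keeps, State.AgreeAt, State.putI]
  | rput s a r c e => intro l hl; cases l <;> simp_all [Cmd.keeps, State.AgreeAt, State.putR]
  | seq _ _ h₁ h₂ => exact h₁.seq_left.trans h₂.seq_right
  | ite_true _ _ h => exact h.ite_left
  | ite_false _ _ h => exact h.ite_right
  | loop_false _ => exact .refl _ _
  | loop_true _ _ _ h₁ h₂ => exact h₁.loop.trans h₂

section Memory

variable (s : State)

@[simp, grind =] theorem State.setI_ivar (v k w : ℕ) :
    (s.setI v k).ivar w = if w = v then k else s.ivar w := by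
  simp [State.setI, Function.update_apply]

@[simp, grind =] theorem State.setI_rvar (v k w : ℕ) :
    (s.setI v k).rvar w = s.rvar w := rfl

@[simp, grind =] theorem State.setI_iarr (v k a i j : ℕ) :
    (s.setI v k).iarr a i j = s.iarr a i j := rfl

@[simp, grind =] theorem State.setI_rarr (v k a i j : ℕ) :
    (s.setI v k).rarr a i j = s.rarr a i j := rfl

@[simp, grind =] theorem State.setR_rvar (v w : ℕ) (r : ℝ) :
    (s.setR v r).rvar w = if w = v then r else s.rvar w := by
  simp [State.setR, Function.update_apply]

@[simp, grind =] theorem State.setR_ivar (v w : ℕ) (r : ℝ) :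
    (s.setR v r).ivar w = s.ivar w := rfl

@[simp, grind =] theorem State.setR_iarr (v a i j : ℕ) (r : ℝ) :
    (s.setR v r).iarr a i j = s.iarr a i j := rfl

@[simp, grind =] theorem State.setR_rarr (v a i j : ℕ) (r : ℝ) :
    (s.setR v r).rarr a i j = s.rarr a i j := rfl

@[simp, grind =] theorem State.putI_iarr (a i j k a' i' j' : ℕ) :
    (s.putI a i j k).iarr a' i' j' =
      if a' = a ∧ i' = i ∧ j' = j then k else s.iarr a' i' j' := by
  simp only [State.putI, Function.update_apply]
  by_cases hrow : i' = i <;> split_ifs <;> simp_all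

@[simp, grind =] theorem State.putI_ivar (a i j k w : ℕ) :
    (s.putI a i j k).ivar w = s.ivar w := rfl

@[simp, grind =] theorem State.putI_rvar (a i j k w : ℕ) :
    (s.putI a i j k).rvar w = s.rvar w := rfl

@[simp, grind =] theorem State.putI_rarr (a i j k a' i' j' : ℕ) :
    (s.putI a i j k).rarr a' i' j' = s.rarr a' i' j' := rfl

@[simp, grind =] theorem State.putR_rarr (a i j a' i' j' : ℕ) (r : ℝ) :
    (s.putR a i j r).rarr a' i' j' =
      if a' = a ∧ i' = i ∧ j' = j then r else s.rarr a' i' j' := by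
  simp only [State.putR, Function.update_apply]
  by_cases hrow : i' = i <;> split_ifs <;> simp_all

@[simp, grind =] theorem State.putR_ivar (a i j w : ℕ) (r : ℝ) :
    (s.putR a i j r).ivar w = s.ivar w := rfl

@[simp, grind =] theorem State.putR_rvar (a i j w : ℕ) (r : ℝ) :
    (s.putR a i j r).rvar w = s.rvar w := rfl

@[simp, grind =] theorem State.putR_iarr (a i j a' i' j' : ℕ) (r : ℝ) :
    (s.putR a i j r).iarr a' i' j' = s.iarr a' i' j' := rfl

end Memory

/-! ### Total correctness with a cost budget -/

/-- Started in `s`, the program `c` halts with cost at most `K` in a memory that satisfies `Q`. -/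
def Run (c : Cmd) (s : State) (K : ℕ) (Q : State → Prop) : Prop :=
  ∃ s' k, Exec c s s' k ∧ k ≤ K ∧ Q s'

theorem Run.mono {c : Cmd} {s : State} {K K' : ℕ} {Q Q' : State → Prop} (h : Run c s K Q)
    (hK : K ≤ K') (hQ : ∀ s', Frame c s s' → Q s' → Q' s') : Run c s K' Q' := by
  obtain ⟨s', k, he, hk, hq⟩ := h
  exact ⟨s', k, he, hk.trans hK, hQ _ he.frame hq⟩

theorem Run.seq {c₁ c₂ : Cmd} {s : State} {K₁ K₂ : ℕ} {P Q : State → Prop} (h₁ : Run c₁ s K₁ P)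
    (h₂ : ∀ s', Frame c₁ s s' → P s' → Run c₂ s' K₂ Q) : Run (.seq c₁ c₂) s (K₁ + K₂) Q := by
  obtain ⟨s₁, k₁, he₁, hk₁, hp⟩ := h₁
  obtain ⟨s₂, k₂, he₂, hk₂, hq⟩ := h₂ s₁ he₁.frame hp
  exact ⟨s₂, _, he₁.seq he₂, by omega, hq⟩

theorem Run.loop {b : BExpr} {c : Cmd} {s₀ : State} (Inv : State → Prop) (V : State → ℕ) {K : ℕ}
    (hinit : Inv s₀)
    (hstep : ∀ s, Frame (.loop b c) s₀ s → Inv s → b.holds s →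
      Run c s K fun s' => Inv s' ∧ V s' < V s) :
    Run (.loop b c) s₀ ((V s₀ + 1) * (K + b.cost + 1)) fun s => Inv s ∧ ¬ b.holds s := by
  induction hm : V s₀ using Nat.strong_induction_on generalizing s₀ with
  | _ m ih =>
    by_cases hb : b.holds s₀
    · obtain ⟨s₁, k₁, he₁, hk₁, hInv, hV⟩ := hstep s₀ (.refl _ _) hinit hb
      obtain ⟨s₂, k₂, he₂, hk₂, hpost⟩ := ih (V s₁) (hm ▸ hV) hInv
        (fun s hF => hstep s (he₁.frame.loop.trans hF)) rfl
      refine ⟨s₂, _, .loop_true hb he₁ he₂, ?_, hpost⟩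
      have hrest : (V s₁ + 1) * (K + b.cost + 1) ≤ m * (K + b.cost + 1) := by
        gcongr
        omega
      linarith
    · exact ⟨s₀, _, .loop_false hb, by nlinarith, hinit, hb⟩

/-! ### Programs without loops -/

/-- `c` contains no loop. -/
def Cmd.loopFree : Cmd → Bool
  | .seq c₁ c₂ => c₁.loopFree && c₂.loopFree
  | .ite _ c₁ c₂ => c₁.loopFree && c₂.loopFree
  | .loop _ _ => false
  | _ => true

open Classical in
/-- The memory after a run of a program without loops; the value at a loop is irrelevant. -/
noncomputable def Cmd.result : Cmd → State → State
  | .skip, s => s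
  | .iset v e, s => s.setI v (e.eval s)
  | .rset v e, s => s.setR v (e.eval s)
  | .iput a row col e, s => s.putI a (row.eval s) (col.eval s) (e.eval s)
  | .rput a row col e, s => s.putR a (row.eval s) (col.eval s) (e.eval s)
  | .seq c₁ c₂, s => c₂.result (c₁.result s)
  | .ite b c₁ c₂, s => if b.holds s then c₁.result s else c₂.result s
  | .loop _ _, s => s

/-- An upper bound for the cost of a program without loops; the value at a loop is irrelevant. -/
def Cmd.maxCost : Cmd → ℕ
  | .skip => 1
  | .iset _ e => e.cost + 1
  | .rset _ e => e.cost + 1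
  | .iput _ row col e => row.cost + col.cost + e.cost + 1
  | .rput _ row col e => row.cost + col.cost + e.cost + 1
  | .seq c₁ c₂ => c₁.maxCost + c₂.maxCost
  | .ite b c₁ c₂ => b.cost + 1 + (c₁.maxCost + c₂.maxCost)
  | .loop _ _ => 0

theorem Run.of_loopFree {c : Cmd} (hc : c.loopFree = true) (s : State) :
    Run c s c.maxCost fun s' => s' = c.result s := by
  induction c generalizing s with
  | skip => exact ⟨_, _, .skip s, le_rfl, rfl⟩
  | iset v e => exact ⟨_, _, .iset s v e, le_rfl, rfl⟩
  | rset v e => exact ⟨_, _, .rset s v e, le_rfl, rfl⟩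
  | iput a r c e => exact ⟨_, _, .iput s a r c e, le_rfl, rfl⟩
  | rput a r c e => exact ⟨_, _, .rput s a r c e, le_rfl, rfl⟩
  | seq c₁ c₂ h₁ h₂ =>
    exact (h₁ (Bool.and_elim_left hc) s).seq fun s' _ e => e ▸ h₂ (Bool.and_elim_right hc) _
  | ite b c₁ c₂ h₁ h₂ =>
    by_cases hb : b.holds s
    · obtain ⟨s', k, he, hk, hq⟩ := h₁ (Bool.and_elim_left hc) s
      exact ⟨s', _, .ite_true hb he, by simp only [Cmd.maxCost]; omega,
        by simp [Cmd.result, hb, hq]⟩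
    · obtain ⟨s', k, he, hk, hq⟩ := h₂ (Bool.and_elim_right hc) s
      exact ⟨s', _, .ite_false hb he, by simp only [Cmd.maxCost]; omega,
        by simp [Cmd.result, hb, hq]⟩
  | loop b c => simp [Cmd.loopFree] at hc

theorem Run.of_result {c : Cmd} {s : State} {K : ℕ} {Q : State → Prop} (hc : c.loopFree = true)
    (hK : c.maxCost ≤ K) (h : Q (c.result s)) : Run c s K Q :=
  (Run.of_loopFree hc s).mono hK fun _ _ e => e ▸ h

/-! ### Counting loops -/

/-- Run `c` for the values `0, …, N - 1` of the index variable `v`. -/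
def forLoop (v : ℕ) (N : IExpr) (c : Cmd) : Cmd :=
  .seq (.iset v (.const 0))
    (.loop (.not (.ile N (.var v))) (.seq c (.iset v (.add (.var v) (.const 1)))))

section ForLoop

variable {v : ℕ} {N : IExpr} {c : Cmd} {s₀ : State} {m K : ℕ} (Inv : ℕ → State → Prop)

theorem Run.forLoop_body (hc : c.keeps (.ivar v) = true) {i : ℕ} (him : i < m) {s : State}
    (hi : s.ivar v = i) (h : Run c s K fun s' => Inv (i + 1) (s'.setI v (i + 1))) :
    Run (.seq c (.iset v (.add (.var v) (.const 1)))) s (K + 4) fun s' =>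
      (s'.ivar v ≤ m ∧ Inv (s'.ivar v) s') ∧ m - s'.ivar v < m - s.ivar v := by
  refine h.seq fun s' hF hInv => Run.of_result rfl le_rfl ?_
  simp only [Cmd.result, IExpr.eval, hF.ivar v hc, hi, State.setI_ivar, if_pos]
  exact ⟨⟨him, hInv⟩, by omega⟩

theorem Run.forLoop (hc : c.keeps (.ivar v) = true)
    (hN : ∀ s, Frame (forLoop v N c) s₀ s → N.eval s = m) (hinit : Inv 0 (s₀.setI v 0))
    (hstep : ∀ i < m, ∀ s, Frame (RealRAM.forLoop v N c) s₀ s → s.ivar v = i → Inv i s →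
      Run c s K fun s' => Inv (i + 1) (s'.setI v (i + 1))) :
    Run (RealRAM.forLoop v N c) s₀ ((m + 1) * (K + N.cost + 10)) (Inv m) := by
  have hreset : Run (.iset v (.const 0)) s₀ 2 fun s => s = s₀.setI v 0 :=
    Run.of_result rfl le_rfl rfl
  refine Run.mono (K := 2 + (m + 1) * (K + 4 + (N.cost + 3) + 1)) (Q := fun s =>
    (s.ivar v ≤ m ∧ Inv (s.ivar v) s) ∧ ¬ ¬ N.eval s ≤ s.ivar v)
    (hreset.seq fun s hF hs => ?_) (by linarith) fun s hF ⟨⟨hle, hInv⟩, hge⟩ => ?_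
  · subst hs
    refine (Run.loop (K := K + 4) (fun s => s.ivar v ≤ m ∧ Inv (s.ivar v) s)
      (fun s => m - s.ivar v) (by simpa using hinit) fun s hF' hInv hlt => ?_).mono
      (by simp [BExpr.cost, IExpr.cost]) fun _ _ h => h
    have hframe : Frame (RealRAM.forLoop v N c) s₀ s := hF.seq_left.trans hF'.seq_right
    have him : s.ivar v < m := by simpa [BExpr.holds, IExpr.eval, hN s hframe] using hlt
    exact forLoop_body Inv hc him rfl (hstep _ him s hframe rfl hInv.2)
  · rw [not_not, hN s hF] at hge
    exact hle.antisymm hge ▸ hInv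

theorem Run.forLoop_of_loopFree (hfree : c.loopFree = true) (hc : c.keeps (.ivar v) = true)
    (hN : ∀ s, Frame (RealRAM.forLoop v N c) s₀ s → N.eval s = m) (hinit : Inv 0 (s₀.setI v 0))
    (hstep : ∀ i < m, ∀ s, Frame (RealRAM.forLoop v N c) s₀ s → s.ivar v = i → Inv i s →
      Inv (i + 1) ((c.result s).setI v (i + 1)))
    (hK : c.maxCost + N.cost + 10 ≤ K) :
    Run (RealRAM.forLoop v N c) s₀ ((m + 1) * K) (Inv m) :=
  (Run.forLoop Inv hc hN hinit fun i hi s hF hv hInv =>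
    Run.of_result hfree le_rfl (hstep i hi s hF hv hInv)).mono
    (Nat.mul_le_mul_left _ hK) fun _ _ h => h

end ForLoop

end RealRAM

namespace LiF

/-! ### The Hungarian method -/

/-- A partial matching of complementary slackness, in terms of the slacks `c r j ≥ 0` of the dual
constraints: `p j` is the row matched to the column `j < n`, or `n` if `j` is free, every matched
pair has slack `0`, and the matched rows are those below `i`. -/
structure IsTightMatching (n i : ℕ) (c : ℕ → ℕ → ℝ) (p : ℕ → ℕ) : Prop where
  nonneg : ∀ r < n, ∀ j < n, 0 ≤ c r j
  tight : ∀ j < n, p j < n → c (p j) j = 0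
  inj : ∀ j < n, ∀ j' < n, p j < n → p j = p j' → j = j'
  range : ∀ j < n, p j < i ∨ p j = n
  cover : ∀ r < i, ∃ j < n, p j = r

/-- An alternating tree for the matching `p`, rooted at the unmatched row `p n`; the extra column
`n` stands for the root. The tree consists of the columns of nonzero `rank` and of their rows. Every
column `j < n` has a parent column `way j` in the tree: a tree column is reached from the row of its
parent along an edge of slack `0`, and for any other column `minv j` is the least slack of an edge
from the tree, attained at the row of `way j`. The ranks increase away from the root and are at most
the number `cnt` of tree columns. -/
structure IsTree (n : ℕ) (c : ℕ → ℕ → ℝ) (p : ℕ → ℕ) (minv : ℕ → ℝ) (way rank : ℕ → ℕ) (cnt : ℕ) :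
    Prop where
  root : rank n ≠ 0
  card_add : Finset.card {j ∈ Finset.range n | rank j = 0} + cnt = n + 1
  rank_le : ∀ j ≤ n, rank j ≤ cnt
  matched : ∀ j ≤ n, rank j ≠ 0 → p j < n
  way_mem : ∀ j < n, way j ≤ n ∧ rank (way j) ≠ 0
  edge : ∀ j < n, rank j ≠ 0 → rank (way j) < rank j ∧ c (p (way j)) j = 0
  minv_eq : ∀ j < n, rank j = 0 → minv j = c (p (way j)) j
  minv_le : ∀ j < n, rank j = 0 → ∀ k ≤ n, rank k ≠ 0 → minv j ≤ c (p k) j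

/-- The effect on the slacks of lowering the duals of the tree rows and raising those of the tree
columns by `δ`. -/
structure IsDualShift (n : ℕ) (δ : ℝ) (p rank : ℕ → ℕ) (c c' : ℕ → ℕ → ℝ) : Prop where
  tree_row : ∀ k ≤ n, rank k ≠ 0 → ∀ j < n, c' (p k) j = c (p k) j - if rank j = 0 then δ else 0
  other_row : ∀ r, (∀ k ≤ n, rank k ≠ 0 → p k ≠ r) → ∀ j < n,
    c' r j = c r j + if rank j = 0 then 0 else δ

/-- The matching while it is changed along the tree path from a free column to the root: the column
`h` is about to be matched to the row of its parent. -/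
structure IsAugmenting (n i : ℕ) (c : ℕ → ℕ → ℝ) (way rank p : ℕ → ℕ) (h : ℕ) : Prop where
  head_le : h ≤ n
  head_rank : rank h ≠ 0
  tight : ∀ j < n, j ≠ h → p j < n → c (p j) j = 0
  inj : ∀ j ≤ n, ∀ j' ≤ n, j ≠ h → j' ≠ h → p j < n → p j = p j' → j = j'
  range : ∀ j ≤ n, j ≠ h → p j < i ∨ p j = n
  cover : ∀ r < i, ∃ j ≤ n, j ≠ h ∧ p j = r
  path : ∀ j < n, rank j ≠ 0 → rank j ≤ rank h →
    way j ≤ n ∧ rank (way j) ≠ 0 ∧ rank (way j) < rank j ∧ p (way j) < n ∧ c (p (way j)) j = 0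

variable {n i cnt h : ℕ} {δ : ℝ} {c c' : ℕ → ℕ → ℝ} {minv minv' : ℕ → ℝ}
  {p p' way way' rank : ℕ → ℕ}

namespace IsTightMatching

theorem empty (hc : ∀ r < n, ∀ j < n, 0 ≤ c r j) (hp : ∀ j < n, p j = n) :
    IsTightMatching n 0 c p where
  nonneg := hc
  tight j hj hlt := absurd (hp j hj) hlt.ne
  inj j hj _ _ hlt _ := absurd (hp j hj) hlt.ne
  range j hj := .inr (hp j hj)
  cover r hr := absurd hr (Nat.not_lt_zero r)

theorem exists_free (hm : IsTightMatching n i c p) (hi : i < n) : ∃ j < n, p j = n := by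
  by_contra! hne
  have hlt : ∀ j < n, p j < i := fun j hj => (hm.range j hj).resolve_right (hne j hj)
  obtain ⟨j, hj, j', hj', hjj', he⟩ := Finset.exists_ne_map_eq_of_card_lt_of_maps_to
    (s := Finset.range n) (t := Finset.range i) (f := p) (by simpa using hi)
    fun j hj => by simpa using hlt j (by simpa using hj)
  rw [Finset.mem_range] at hj hj'
  exact hjj' (hm.inj j hj j' hj' ((hlt j hj).trans hi) he)

theorem congr (hm : IsTightMatching n i c p) (hp : ∀ j < n, p' j = p j) :
    IsTightMatching n i c p' where
  nonneg := hm.nonneg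
  tight j hj := hp j hj ▸ hm.tight j hj
  inj j hj j' hj' := by rw [hp j hj, hp j' hj']; exact hm.inj j hj j' hj'
  range j hj := hp j hj ▸ hm.range j hj
  cover r hr := (hm.cover r hr).imp fun j ⟨hj, he⟩ => ⟨hj, (hp j hj).trans he⟩

theorem inj_of_root (hm : IsTightMatching n i c p) (hi : i < n) (hroot : p n = i) :
    ∀ j ≤ n, ∀ j' ≤ n, p j < n → p j = p j' → j = j' := by
  have hne : ∀ j < n, p j ≠ p n := fun j hj he => by
    have := hm.range j hj
    omega
  intro j hj j' hj' hlt he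
  rcases hj.lt_or_eq with hj | rfl <;> rcases hj'.lt_or_eq with hj' | rfl
  · exact hm.inj j hj j' hj' hlt he
  · exact absurd he (hne j hj)
  · exact absurd he.symm (hne j' hj')
  · rfl

theorem exists_perm (hm : IsTightMatching n n c p) :
    ∃ σ : Equiv.Perm (Fin n), ∀ r j : Fin n, p j = r ↔ σ r = j := by
  have hcover : ∀ r : Fin n, ∃ j : Fin n, p j = r := fun r =>
    let ⟨j, hj, he⟩ := hm.cover r r.2
    ⟨⟨j, hj⟩, he⟩
  choose f hf using hcover
  have hinj : Function.Injective f := fun r r' he =>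
    Fin.ext ((hf r).symm.trans ((congrArg (fun j : Fin n => p j) he).trans (hf r')))
  refine ⟨.ofBijective f (Finite.injective_iff_bijective.1 hinj), fun r j => ⟨fun he => ?_, ?_⟩⟩
  · exact Fin.ext (hm.inj _ (f r).2 j j.2 ((hf r).trans_lt r.2) ((hf r).trans he.symm))
  · rintro rfl
    exact hf r

theorem dualShift (hm : IsTightMatching n i c p) (hi : i < n) (hroot : p n = i)
    (ht : IsTree n c p minv way rank cnt) (hs : IsDualShift n δ p rank c c') (hδ₀ : 0 ≤ δ)
    (hδ : ∀ j < n, rank j = 0 → δ ≤ minv j) : IsTightMatching n i c' p where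
  nonneg r hr j hj := by
    have hrj := hm.nonneg r hr j hj
    by_cases htree : ∃ k ≤ n, rank k ≠ 0 ∧ p k = r
    · obtain ⟨k, hk, hkr, rfl⟩ := htree
      rw [hs.tree_row k hk hkr j hj]
      split_ifs with hj₀
      · linarith [hδ j hj hj₀, ht.minv_le j hj hj₀ k hk hkr]
      · linarith
    · push Not at htree
      rw [hs.other_row r htree j hj]
      split_ifs <;> linarith
  tight j hj hlt := by
    by_cases hj₀ : rank j = 0
    · have hother : ∀ k ≤ n, rank k ≠ 0 → p k ≠ p j := fun k hk hkr he =>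
        hkr (hm.inj_of_root hi hroot j hj.le k hk hlt he.symm ▸ hj₀)
      simp [hs.other_row _ hother j hj, hj₀, hm.tight j hj hlt]
    · simp [hs.tree_row j hj.le hj₀ j hj, hj₀, hm.tight j hj hlt]
  inj := hm.inj
  range := hm.range
  cover := hm.cover

end IsTightMatching

namespace IsTree

theorem root_only (hroot : p n < n) (hrank : rank n = 1)
    (hinit : ∀ j < n, rank j = 0 ∧ way j = n ∧ minv j = c (p n) j) :
    IsTree n c p minv way rank 1 where
  root := by simp [hrank]
  card_add := by
    rw [Finset.filter_true_of_mem fun j hj => (hinit j (Finset.mem_range.1 hj)).1,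
      Finset.card_range]
  rank_le j hj := by
    rcases hj.lt_or_eq with hj | rfl
    · simp [hinit j hj]
    · exact hrank.le
  matched j hj hjr := by
    rcases hj.lt_or_eq with hj | rfl
    · exact absurd (hinit j hj).1 hjr
    · exact hroot
  way_mem j hj := by simp [hinit j hj, hrank]
  edge j hj hjr := absurd (hinit j hj).1 hjr
  minv_eq j hj _ := by rw [(hinit j hj).2.1, (hinit j hj).2.2]
  minv_le j hj _ k hk hkr := by
    rcases hk.lt_or_eq with hk | rfl
    · exact absurd (hinit k hk).1 hkr
    · exact (hinit j hj).2.2.le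

theorem cnt_le (ht : IsTree n c p minv way rank cnt) (hh : h < n) (hr : rank h = 0) : cnt ≤ n := by
  have hpos : 0 < Finset.card {j ∈ Finset.range n | rank j = 0} :=
    Finset.card_pos.2 ⟨h, by simp [hh, hr]⟩
  have := ht.card_add
  omega

theorem minv_nonneg (ht : IsTree n c p minv way rank cnt) (hm : IsTightMatching n i c p)
    (hh : h < n) (hr : rank h = 0) : 0 ≤ minv h := by
  rw [ht.minv_eq h hh hr]
  exact hm.nonneg _ (ht.matched _ (ht.way_mem h hh).1 (ht.way_mem h hh).2) h hh

theorem dualShift (ht : IsTree n c p minv way rank cnt) (hs : IsDualShift n δ p rank c c')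
    (hminv : ∀ j < n, rank j = 0 → minv' j = minv j - δ) :
    IsTree n c' p minv' way rank cnt where
  root := ht.root
  card_add := ht.card_add
  rank_le := ht.rank_le
  matched := ht.matched
  way_mem := ht.way_mem
  edge j hj hjr := by
    obtain ⟨hw, hwr⟩ := ht.way_mem j hj
    refine ⟨(ht.edge j hj hjr).1, ?_⟩
    rw [hs.tree_row _ hw hwr j hj, (ht.edge j hj hjr).2, if_neg hjr, sub_zero]
  minv_eq j hj hj₀ := by
    obtain ⟨hw, hwr⟩ := ht.way_mem j hj
    rw [hs.tree_row _ hw hwr j hj, if_pos hj₀, hminv j hj hj₀, ht.minv_eq j hj hj₀]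
  minv_le j hj hj₀ k hk hkr := by
    rw [hs.tree_row _ hk hkr j hj, if_pos hj₀, hminv j hj hj₀]
    exact sub_le_sub_right (ht.minv_le j hj hj₀ k hk hkr) δ

theorem card_add_update (ht : IsTree n c p minv way rank cnt) (hh : h < n) (hr : rank h = 0) :
    Finset.card {j ∈ Finset.range n | Function.update rank h (cnt + 1) j = 0} + (cnt + 1) =
      n + 1 := by
  have herase : ({j ∈ Finset.range n | Function.update rank h (cnt + 1) j = 0} : Finset ℕ) =
      Finset.erase {j ∈ Finset.range n | rank j = 0} h := by
    ext j
    simp only [Finset.mem_filter, Finset.mem_erase]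
    grind
  have hmem : h ∈ ({j ∈ Finset.range n | rank j = 0} : Finset ℕ) := by simp [hh, hr]
  rw [herase, ← add_assoc, add_right_comm, Finset.card_erase_add_one hmem, ht.card_add]

theorem edge_update (ht : IsTree n c p minv way rank cnt) (hh : h < n) (hr : rank h = 0)
    (htight : minv h = 0) {j : ℕ} (hj : j < n) (hjr : Function.update rank h (cnt + 1) j ≠ 0) :
    Function.update rank h (cnt + 1) (way j) < Function.update rank h (cnt + 1) j ∧
      c (p (way j)) j = 0 := by
  obtain ⟨hw, hwr⟩ := ht.way_mem j hj
  have hwh : way j ≠ h := fun he => hwr (he ▸ hr)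
  rw [Function.update_of_ne hwh]
  rcases eq_or_ne j h with rfl | hjh
  · rw [Function.update_self, ← ht.minv_eq j hj hr]
    exact ⟨Nat.lt_succ_of_le (ht.rank_le _ hw), htight⟩
  · rw [Function.update_of_ne hjh] at hjr ⊢
    exact ht.edge j hj hjr

theorem absorb (ht : IsTree n c p minv way rank cnt) (hh : h < n) (hr : rank h = 0)
    (htight : minv h = 0) (hp : p h < n)
    (hrelax : ∀ j < n, (minv' j, way' j) =
      if Function.update rank h (cnt + 1) j = 0 ∧ c (p h) j < minv j then (c (p h) j, h)
      else (minv j, way j)) :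
    IsTree n c p minv' way' (Function.update rank h (cnt + 1)) (cnt + 1) := by
  set rank' := Function.update rank h (cnt + 1)
  have hhead : rank' h = cnt + 1 := Function.update_self ..
  have hne : ∀ j, j ≠ h → rank' j = rank j := fun j hj => Function.update_of_ne hj ..
  have hout : ∀ j, rank' j = 0 → rank j = 0 := by grind
  have htree : ∀ j, rank' j ≠ 0 → j = h ∨ rank j ≠ 0 := by grind
  have hstay : ∀ j, rank j ≠ 0 → rank' j ≠ 0 := by grind
  have hway : ∀ j < n, rank' j ≠ 0 → way' j = way j := by grind
  constructor
  case root => exact hstay n ht.root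
  case card_add => exact ht.card_add_update hh hr
  case rank_le =>
    intro j hj
    have := ht.rank_le j hj
    grind
  case matched => exact fun j hj hjr => (htree j hjr).elim (· ▸ hp) (ht.matched j hj)
  case way_mem =>
    intro j hj
    have := ht.way_mem j hj
    grind
  case edge => exact fun j hj hjr => hway j hj hjr ▸ ht.edge_update hh hr htight hj hjr
  case minv_eq =>
    intro j hj hj₀
    have := ht.minv_eq j hj (hout j hj₀)
    grind
  case minv_le =>
    intro j hj hj₀ k hk hkr
    have := ht.minv_le j hj (hout j hj₀) k hk
    grind

theorem isAugmenting (ht : IsTree n c p minv way rank cnt) (hm : IsTightMatching n i c p)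
    (hi : i < n) (hroot : p n = i) (hh : h < n) (hr : rank h = 0) (htight : minv h = 0)
    (hfree : p h = n) :
    IsAugmenting n (i + 1) c way (Function.update rank h (cnt + 1)) p h where
  head_le := hh.le
  head_rank := by simp
  tight j hj _ := hm.tight j hj
  inj j hj j' hj' _ _ := hm.inj_of_root hi hroot j hj j' hj'
  range j hj _ := by
    rcases hj.lt_or_eq with hj | rfl
    · exact (hm.range j hj).imp_left Nat.lt_succ_of_lt
    · exact .inl (by omega)
  cover r hr := by
    rcases Nat.lt_succ_iff_lt_or_eq.1 hr with hr | rfl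
    · obtain ⟨j, hj, he⟩ := hm.cover r hr
      exact ⟨j, hj.le, by rintro rfl; omega, he⟩
    · exact ⟨n, le_rfl, hh.ne', hroot⟩
  path j hj hjr _ := by
    obtain ⟨hw, hwr⟩ := ht.way_mem j hj
    refine ⟨hw, ?_, (ht.edge_update hh hr htight hj hjr).1, ht.matched _ hw hwr,
      (ht.edge_update hh hr htight hj hjr).2⟩
    have hwh : way j ≠ h := fun he => hwr (he ▸ hr)
    rwa [Function.update_of_ne hwh]

end IsTree

namespace IsAugmenting

theorem step (ha : IsAugmenting n i c way rank p h) (hn : h < n) :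
    IsAugmenting n i c way rank (Function.update p h (p (way h))) (way h) ∧
      rank (way h) < rank h := by
  obtain ⟨hw, hwr, hlt, hwp, htight⟩ := ha.path h hn ha.head_rank le_rfl
  have hne : way h ≠ h := fun he => hlt.ne (congrArg rank he)
  refine ⟨⟨hw, hwr, fun j hj _ => ?_, fun j hj j' hj' hjw hjw' => ?_, fun j hj _ => ?_,
    fun r hr => ?_, fun j hj hjr hle => ?_⟩, hlt⟩
  · have := ha.tight j hj
    grind
  · have := ha.inj j hj j' hj'
    have := ha.inj (way h) hw j' hj' hne
    have := ha.inj j hj (way h) hw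
    grind
  · have := ha.range j hj
    have := ha.range (way h) hw hne
    grind
  · obtain ⟨j, hj, hjh, rfl⟩ := ha.cover r hr
    rcases eq_or_ne j (way h) with rfl | hjw
    · exact ⟨h, hn.le, hne.symm, Function.update_self ..⟩
    · exact ⟨j, hj, hjw, Function.update_of_ne hjh ..⟩
  · have hpath := ha.path j hj hjr (hle.trans hlt.le)
    have hwj : way j ≠ h := fun he => by
      rw [he] at hpath
      omega
    rwa [Function.update_of_ne hwj]

theorem isTightMatching (ha : IsAugmenting n i c way rank p n)
    (hc : ∀ r < n, ∀ j < n, 0 ≤ c r j) : IsTightMatching n i c p where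
  nonneg := hc
  tight j hj := ha.tight j hj hj.ne
  inj j hj j' hj' := ha.inj j hj.le j' hj'.le hj.ne hj'.ne
  range j hj := ha.range j hj.le hj.ne
  cover r hr :=
    let ⟨j, hj, hne, he⟩ := ha.cover r hr
    ⟨j, hj.lt_of_ne hne, he⟩

end IsAugmenting

end LiF

namespace LiF

open RealRAM

/-! ### A program for the Hungarian method -/

/- The first two index variables, the first real variable and the first two real arrays are the ones
that `Stores` prescribes. Vectors occupy row `0` of an array. A column `j < n` is free when its mate
is `n`, and the column `n` is the root of the alternating tree. -/

@[simp] abbrev sizeVar : ℕ := 0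
@[simp] abbrev stepVar : ℕ := 1
@[simp] abbrev rowVar : ℕ := 2
@[simp] abbrev colVar : ℕ := 3
@[simp] abbrev headVar : ℕ := 4
@[simp] abbrev countVar : ℕ := 5
@[simp] abbrev kappaVar : ℕ := 0
@[simp] abbrev utilityVar : ℕ := 1
@[simp] abbrev shiftVar : ℕ := 2
@[simp] abbrev thresholdVar : ℕ := 3
@[simp] abbrev utilArr : ℕ := 0
@[simp] abbrev iterArr : ℕ := 1
@[simp] abbrev weightArr : ℕ := 2
@[simp] abbrev rowDualArr : ℕ := 3
@[simp] abbrev colDualArr : ℕ := 4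
@[simp] abbrev minSlackArr : ℕ := 5
@[simp] abbrev mateArr : ℕ := 0
@[simp] abbrev parentArr : ℕ := 1
@[simp] abbrev rankArr : ℕ := 2

/-- The entry `e` of the index vector `a`. -/
abbrev ivec (a : ℕ) (e : IExpr) : IExpr := .get a (.const 0) e

/-- The entry `e` of the real vector `a`. -/
abbrev rvec (a : ℕ) (e : IExpr) : RExpr := .get a (.const 0) e

/-- The slack of the dual constraint of the row `r` and the column `j`. -/
def slackMatrix (s : State) (r j : ℕ) : ℝ :=
  s.rarr rowDualArr 0 r + s.rarr colDualArr 0 j - s.rarr weightArr r j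

/-- The expression for an entry of `slackMatrix`. -/
def slackExpr (r j : IExpr) : RExpr :=
  .sub (.add (rvec rowDualArr r) (rvec colDualArr j)) (.get weightArr r j)

theorem slackExpr_eval (s : State) (r j : IExpr) :
    (slackExpr r j).eval s = slackMatrix s (r.eval s) (j.eval s) := rfl

@[simp] theorem slackMatrix_setI (s : State) (v k : ℕ) :
    slackMatrix (s.setI v k) = slackMatrix s := rfl

@[simp] theorem slackMatrix_setR (s : State) (v : ℕ) (r : ℝ) :
    slackMatrix (s.setR v r) = slackMatrix s := rfl

@[simp] theorem slackMatrix_putI (s : State) (a r j k : ℕ) :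
    slackMatrix (s.putI a r j k) = slackMatrix s := rfl

theorem slackMatrix_eq_of_frame {c : Cmd} {s s' : State} (hF : Frame c s s')
    (hc : [Loc.rarr rowDualArr, .rarr colDualArr, .rarr weightArr].all c.keeps = true) :
    slackMatrix s' = slackMatrix s := by
  simp only [List.all_cons, List.all_nil, Bool.and_true, Bool.and_eq_true] at hc
  funext r j
  rw [slackMatrix, hF.rarr _ hc.1, hF.rarr _ hc.2.1, hF.rarr _ hc.2.2, slackMatrix]

attribute [local simp] Cmd.result IExpr.eval RExpr.eval BExpr.holds slackExpr_eval

variable {n i : ℕ} {s : State}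

/-- The memory holds a tight matching of the rows below `i`. -/
structure HoldsMatching (n i : ℕ) (s : State) : Prop where
  size : s.ivar sizeVar = n
  matching : IsTightMatching n i (slackMatrix s) (s.iarr mateArr 0)

/-- The memory holds a tight matching of the rows below `i` and an alternating tree whose root is
the row `i`. -/
structure HoldsTree (n i : ℕ) (s : State) : Prop extends HoldsMatching n i s where
  root : s.iarr mateArr 0 n = i
  tree : IsTree n (slackMatrix s) (s.iarr mateArr 0) (s.rarr minSlackArr 0) (s.iarr parentArr 0)
    (s.iarr rankArr 0) (s.ivar countVar)

/-- The head is a column outside the tree that can be reached from it along an edge of slack `0`. -/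
structure HoldsHead (n : ℕ) (s : State) : Prop where
  head_lt : s.ivar headVar < n
  rank_eq : s.iarr rankArr 0 (s.ivar headVar) = 0
  minSlack_eq : s.rarr minSlackArr 0 (s.ivar headVar) = 0

/-- Remove all columns below `n` from the tree. -/
def clearTree : Cmd :=
  forLoop colVar (.var sizeVar)
    (.seq (.iput rankArr (.const 0) (.var colVar) (.const 0))
      (.seq (.iput parentArr (.const 0) (.var colVar) (.var sizeVar))
        (.rput minSlackArr (.const 0) (.var colVar) (slackExpr (.var rowVar) (.var colVar)))))

theorem run_clearTree (hn : s.ivar sizeVar = n) :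
    Run clearTree s ((n + 1) * 40) fun s' => ∀ j < n, s'.iarr rankArr 0 j = 0 ∧
      s'.iarr parentArr 0 j = n ∧ s'.rarr minSlackArr 0 j = slackMatrix s (s.ivar rowVar) j := by
  refine Run.forLoop_of_loopFree (fun m s' => ∀ j < m, s'.iarr rankArr 0 j = 0 ∧
    s'.iarr parentArr 0 j = n ∧ s'.rarr minSlackArr 0 j = slackMatrix s (s.ivar rowVar) j)
    rfl rfl (fun s' hF => (hF.ivar sizeVar rfl).trans hn) (by simp) ?_ (by decide)
  intro m _ s' hF hj hInv j hjm
  have hslack := slackMatrix_eq_of_frame hF rfl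
  have hrow := hF.ivar rowVar rfl
  have hsize := (hF.ivar sizeVar rfl).trans hn
  have hold := hInv j
  simp only [Cmd.result, IExpr.eval, slackExpr_eval, State.putI_ivar, slackMatrix_putI, hj, hslack,
    hrow, hsize]
  grind

/-- Make the row in `rowVar` the root of a new tree. -/
def plantTree : Cmd :=
  .seq clearTree (.seq (.iput mateArr (.const 0) (.var sizeVar) (.var rowVar))
    (.seq (.iput rankArr (.const 0) (.var sizeVar) (.const 1)) (.iset countVar (.const 1))))

theorem run_plantTree (hi : i < n) (hrow : s.ivar rowVar = i) (h : HoldsMatching n i s) :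
    Run plantTree s ((n + 1) * 60) (HoldsTree n i) := by
  refine Run.mono (K := (n + 1) * 40 + 10) ((run_clearTree h.size).seq fun s' hF hclear =>
    Run.of_result rfl (by decide) ?_) (by omega) fun _ _ h => h
  have hslack := slackMatrix_eq_of_frame hF rfl
  have hmate := hF.iarr mateArr rfl
  have hrow' := (hF.ivar rowVar rfl).trans hrow
  have hsize := (hF.ivar sizeVar rfl).trans h.size
  constructor
  case toHoldsMatching =>
    refine ⟨by simpa using hsize, ?_⟩
    simp only [Cmd.result, slackMatrix_setI, slackMatrix_putI, hslack]
    exact h.matching.congr fun j hj => by simp [hmate, hsize, hj.ne]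
  case root => simp [hsize, hrow']
  case tree =>
    refine IsTree.root_only ?_ ?_ fun j hj => ?_
    · simp [hsize, hrow', hi]
    · simp [hsize]
    · simp [hclear j hj, hsize, hrow', hj.ne, hrow, hslack]

/-- Let the row matched to the head, which is a tree column, compete for the other columns. -/
def relax : Cmd :=
  forLoop colVar (.var sizeVar)
    (.ite (.and (.ile (ivec rankArr (.var colVar)) (.const 0))
        (.not (.rle (rvec minSlackArr (.var colVar))
          (slackExpr (ivec mateArr (.var headVar)) (.var colVar)))))
      (.seq (.rput minSlackArr (.const 0) (.var colVar)
          (slackExpr (ivec mateArr (.var headVar)) (.var colVar)))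
        (.iput parentArr (.const 0) (.var colVar) (.var headVar)))
      .skip)

theorem run_relax (hn : s.ivar sizeVar = n) :
    Run relax s ((n + 1) * 80) fun s' => ∀ j < n,
      (s'.rarr minSlackArr 0 j, s'.iarr parentArr 0 j) =
        if s.iarr rankArr 0 j = 0 ∧
            slackMatrix s (s.iarr mateArr 0 (s.ivar headVar)) j < s.rarr minSlackArr 0 j then
          (slackMatrix s (s.iarr mateArr 0 (s.ivar headVar)) j, s.ivar headVar)
        else (s.rarr minSlackArr 0 j, s.iarr parentArr 0 j) := by
  refine Run.mono (Run.forLoop_of_loopFree (m := n) (fun m s' => ∀ j,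
    (s'.rarr minSlackArr 0 j, s'.iarr parentArr 0 j) =
      if j < m ∧ s.iarr rankArr 0 j = 0 ∧
          slackMatrix s (s.iarr mateArr 0 (s.ivar headVar)) j < s.rarr minSlackArr 0 j then
        (slackMatrix s (s.iarr mateArr 0 (s.ivar headVar)) j, s.ivar headVar)
      else (s.rarr minSlackArr 0 j, s.iarr parentArr 0 j))
    rfl rfl (fun s' hF => (hF.ivar sizeVar rfl).trans hn) (by simp) ?_ (by decide)) le_rfl
      fun s' _ h j hj => by simpa [hj] using h j
  intro m _ s' hF hj hInv j
  have hslack := slackMatrix_eq_of_frame hF rfl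
  have hhead := hF.ivar headVar rfl
  have hmate := hF.iarr mateArr rfl
  have hrank := hF.iarr rankArr rfl
  have hold := hInv j
  simp only [Cmd.result, IExpr.eval, RExpr.eval, BExpr.holds, slackExpr_eval, hj, hslack, hhead,
    hmate, hrank]
  split_ifs <;> grind

/-- Add the head to the tree. -/
def absorb : Cmd :=
  .seq (.seq (.iset countVar (.add (.var countVar) (.const 1)))
    (.iput rankArr (.const 0) (.var headVar) (.var countVar))) relax

theorem run_absorb (h : HoldsTree n i s) (hh : HoldsHead n s)
    (hp : s.iarr mateArr 0 (s.ivar headVar) < n) :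
    Run absorb s ((n + 1) * 100) fun s' =>
      HoldsTree n i s' ∧ s'.ivar countVar = s.ivar countVar + 1 := by
  have hmark : Run (.seq (.iset countVar (.add (.var countVar) (.const 1)))
      (.iput rankArr (.const 0) (.var headVar) (.var countVar))) s 10 fun s' =>
      s'.ivar countVar = s.ivar countVar + 1 ∧ s'.iarr rankArr 0 =
        Function.update (s.iarr rankArr 0) (s.ivar headVar) (s.ivar countVar + 1) :=
    Run.of_result rfl (by decide) ⟨by simp, by ext; simp [Function.update_apply]⟩
  refine Run.mono (K := 10 + (n + 1) * 80) (hmark.seq fun s₁ hF₁ ⟨hcount, hrank⟩ =>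
    (run_relax ((hF₁.ivar sizeVar rfl).trans h.size)).mono le_rfl fun s' hF₂ hrelax => ?_)
    (by omega) fun _ _ h => h
  have hslack₁ := slackMatrix_eq_of_frame hF₁ rfl
  have hslack := (slackMatrix_eq_of_frame hF₂ rfl).trans hslack₁
  have hmate := (hF₂.iarr mateArr rfl).trans (hF₁.iarr mateArr rfl)
  have hcount' := (hF₂.ivar countVar rfl).trans hcount
  refine ⟨⟨⟨?_, ?_⟩, ?_, ?_⟩, hcount'⟩
  · exact (hF₂.ivar sizeVar rfl).trans ((hF₁.ivar sizeVar rfl).trans h.size)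
  · rw [hslack, hmate]
    exact h.matching
  · rw [hmate]
    exact h.root
  · rw [hslack, hmate, hcount', hF₂.iarr rankArr rfl, hrank]
    refine h.tree.absorb hh.head_lt hh.rank_eq hh.minSlack_eq hp fun j hj => ?_
    rw [hrelax j hj, hslack₁, hrank, hF₁.ivar headVar rfl, hF₁.iarr mateArr rfl,
      hF₁.rarr minSlackArr rfl, hF₁.iarr parentArr rfl]

/-- Let the head be a column of least slack outside the tree, if there is one. -/
def select : Cmd :=
  .seq (.iset headVar (.var sizeVar))
    (forLoop colVar (.var sizeVar)
      (.ite (.and (.ile (ivec rankArr (.var colVar)) (.const 0))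
          (.not (.and (.not (.ile (.var sizeVar) (.var headVar)))
            (.rle (rvec minSlackArr (.var headVar)) (rvec minSlackArr (.var colVar))))))
        (.iset headVar (.var colVar)) .skip))

/-- Among the columns below `m` that are outside the tree, the head is one of least slack; it is `n`
if there is no such column. -/
def IsLeastBelow (n m : ℕ) (s : State) : Prop :=
  (s.ivar headVar = n ∨ s.ivar headVar < n ∧ s.iarr rankArr 0 (s.ivar headVar) = 0) ∧
    ∀ j < m, s.iarr rankArr 0 j = 0 → s.ivar headVar < n ∧
      s.rarr minSlackArr 0 (s.ivar headVar) ≤ s.rarr minSlackArr 0 j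

theorem run_select (hn : s.ivar sizeVar = n) :
    Run select s ((n + 1) * 60) (IsLeastBelow n n) := by
  have hreset : Run (.iset headVar (.var sizeVar)) s 2 fun s' => s'.ivar headVar = n :=
    Run.of_result rfl (by decide) (by simpa using hn)
  refine Run.mono (K := 2 + (n + 1) * 50) (hreset.seq fun s₁ hF₁ hhead =>
    Run.forLoop_of_loopFree (IsLeastBelow n) rfl rfl
      (fun s' hF => (hF.ivar sizeVar rfl).trans ((hF₁.ivar sizeVar rfl).trans hn))
      (by simp [IsLeastBelow, hhead]) ?_ (by decide)) (by omega) fun _ _ h => h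
  rintro m hm s' hF hj ⟨hmem, hleast⟩
  have hsize := (hF.ivar sizeVar rfl).trans ((hF₁.ivar sizeVar rfl).trans hn)
  simp only [Cmd.result, IExpr.eval, RExpr.eval, BExpr.holds, hj, hsize, IsLeastBelow]
  split_ifs <;> grind

theorem IsLeastBelow.head_mem (h : IsLeastBelow n n s)
    (hfree : ∃ j < n, s.iarr rankArr 0 j = 0) :
    s.ivar headVar < n ∧ s.iarr rankArr 0 (s.ivar headVar) = 0 := by
  obtain ⟨j, hj, hj₀⟩ := hfree
  exact h.1.resolve_left (h.2 j hj hj₀).1.ne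

/-- Lower the duals of the tree rows and raise those of the tree columns by `shiftVar`, which lowers
the slacks of the edges leaving the tree. -/
def shiftDuals : Cmd :=
  forLoop colVar (.add (.var sizeVar) (.const 1))
    (.ite (.ile (ivec rankArr (.var colVar)) (.const 0))
      (.rput minSlackArr (.const 0) (.var colVar)
        (.sub (rvec minSlackArr (.var colVar)) (.var shiftVar)))
      (.seq (.rput rowDualArr (.const 0) (ivec mateArr (.var colVar))
          (.sub (rvec rowDualArr (ivec mateArr (.var colVar))) (.var shiftVar)))
        (.rput colDualArr (.const 0) (.var colVar)
          (.add (rvec colDualArr (.var colVar)) (.var shiftVar)))))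

/-- The memory `s'` arises from `s` by shifting the duals along the columns below `m`. -/
structure IsShiftedBelow (s : State) (m : ℕ) (s' : State) : Prop where
  minSlack : ∀ j, s'.rarr minSlackArr 0 j =
    s.rarr minSlackArr 0 j - if j < m ∧ s.iarr rankArr 0 j = 0 then s.rvar shiftVar else 0
  colDual : ∀ j, s'.rarr colDualArr 0 j =
    s.rarr colDualArr 0 j + if j < m ∧ s.iarr rankArr 0 j ≠ 0 then s.rvar shiftVar else 0
  tree_row : ∀ k < m, s.iarr rankArr 0 k ≠ 0 → s'.rarr rowDualArr 0 (s.iarr mateArr 0 k) =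
    s.rarr rowDualArr 0 (s.iarr mateArr 0 k) - s.rvar shiftVar
  other_row : ∀ r, (∀ k < m, s.iarr rankArr 0 k ≠ 0 → s.iarr mateArr 0 k ≠ r) →
    s'.rarr rowDualArr 0 r = s.rarr rowDualArr 0 r

theorem run_shiftDuals (hn : s.ivar sizeVar = n)
    (hinj : ∀ k ≤ n, ∀ k' ≤ n, s.iarr rankArr 0 k ≠ 0 →
      s.iarr mateArr 0 k = s.iarr mateArr 0 k' → k = k') :
    Run shiftDuals s ((n + 2) * 60) (IsShiftedBelow s (n + 1)) := by
  refine Run.forLoop_of_loopFree (IsShiftedBelow s) rfl rfl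
    (fun s' hF => congrArg (· + 1) ((hF.ivar sizeVar rfl).trans hn))
    (by constructor <;> simp) ?_ (by decide)
  rintro m hm s' hF hj ⟨hminSlack, hcolDual, htree, hother⟩
  have hshift := hF.rvar shiftVar rfl
  have hmate := hF.iarr mateArr rfl
  have hrank := hF.iarr rankArr rfl
  have hfresh : ∀ k < m, s.iarr rankArr 0 k ≠ 0 → s.iarr mateArr 0 k ≠ s.iarr mateArr 0 m :=
    fun k hk hkr he => hk.ne (hinj k (by omega) m (by omega) hkr he)
  simp only [Cmd.result, IExpr.eval, RExpr.eval, BExpr.holds, hj, hshift, hmate, hrank]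
  constructor
  case minSlack => intro j; have := hminSlack j; split_ifs <;> grind
  case colDual => intro j; have := hcolDual j; split_ifs <;> grind
  case tree_row =>
    intro k hk hkr
    have := htree k
    have := hfresh k
    have := hother (s.iarr mateArr 0 m)
    split_ifs <;> grind
  case other_row =>
    intro r hr
    have := hr m
    have := hother r fun k hk => hr k (by omega)
    split_ifs <;> grind

theorem IsShiftedBelow.isDualShift {s' : State} (h : IsShiftedBelow s (n + 1) s')
    (hF : Frame shiftDuals s s') :
    IsDualShift n (s.rvar shiftVar) (s.iarr mateArr 0) (s.iarr rankArr 0) (slackMatrix s)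
      (slackMatrix s') where
  tree_row k hk hkr j hj := by
    simp only [slackMatrix, hF.rarr weightArr rfl, h.colDual, h.tree_row k (by omega) hkr]
    grind
  other_row r hr j hj := by
    simp only [slackMatrix, hF.rarr weightArr rfl, h.colDual,
      h.other_row r fun k hk => hr k (by omega)]
    grind

/-- Let the shift be the least slack of a column outside the tree, attained at the head. -/
def chooseShift : Cmd :=
  .seq select (.rset shiftVar (rvec minSlackArr (.var headVar)))

theorem run_chooseShift (hn : s.ivar sizeVar = n) :
    Run chooseShift s ((n + 1) * 70) fun s' => IsLeastBelow n n s' ∧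
      s'.rvar shiftVar = s'.rarr minSlackArr 0 (s'.ivar headVar) := by
  refine Run.mono (K := (n + 1) * 60 + 10) ((run_select hn).seq fun s₁ _ hleast =>
    Run.of_result rfl (by decide) ⟨?_, ?_⟩) (by omega) fun _ _ h => h
  · exact hleast
  · simp [Cmd.result, RExpr.eval, IExpr.eval]

theorem HoldsTree.exists_rank_eq_zero (h : HoldsTree n i s) (hi : i < n) :
    ∃ j < n, s.iarr rankArr 0 j = 0 := by
  obtain ⟨j, hj, hfree⟩ := h.matching.exists_free hi
  by_contra! hrank
  exact (h.tree.matched j hj.le (hrank j hj)).ne hfree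

theorem HoldsTree.of_frame {c : Cmd} {s' : State} (h : HoldsTree n i s) (hF : Frame c s s')
    (hc : [Loc.ivar sizeVar, .ivar countVar, .iarr mateArr, .iarr parentArr, .iarr rankArr,
      .rarr minSlackArr].all c.keeps = true)
    (hslack : [Loc.rarr rowDualArr, .rarr colDualArr, .rarr weightArr].all c.keeps = true) :
    HoldsTree n i s' := by
  simp only [List.all_cons, List.all_nil, Bool.and_true, Bool.and_eq_true] at hc
  obtain ⟨hsize, hcount, hmate, hparent, hrank, hminSlack⟩ := hc
  have hslack' := slackMatrix_eq_of_frame hF hslack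
  refine ⟨⟨(hF.ivar _ hsize).trans h.size, ?_⟩, ?_, ?_⟩
  · rw [hslack', hF.iarr _ hmate]
    exact h.matching
  · rw [hF.iarr _ hmate]
    exact h.root
  · rw [hslack', hF.iarr _ hmate, hF.rarr _ hminSlack, hF.iarr _ hparent, hF.iarr _ hrank,
      hF.ivar _ hcount]
    exact h.tree

theorem HoldsTree.shift {s' : State} (h : HoldsTree n i s) (hi : i < n)
    (hF : Frame shiftDuals s s') (hs : IsShiftedBelow s (n + 1) s') (hδ₀ : 0 ≤ s.rvar shiftVar)
    (hδ : ∀ j < n, s.iarr rankArr 0 j = 0 → s.rvar shiftVar ≤ s.rarr minSlackArr 0 j) :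
    HoldsTree n i s' := by
  have hshift := hs.isDualShift hF
  refine ⟨⟨(hF.ivar sizeVar rfl).trans h.size, ?_⟩, ?_, ?_⟩
  · rw [hF.iarr mateArr rfl]
    exact h.matching.dualShift hi h.root h.tree hshift hδ₀ hδ
  · rw [hF.iarr mateArr rfl]
    exact h.root
  · rw [hF.iarr mateArr rfl, hF.iarr parentArr rfl, hF.iarr rankArr rfl, hF.ivar countVar rfl]
    refine h.tree.dualShift hshift fun j hj hj₀ => ?_
    rw [hs.minSlack, if_pos ⟨by omega, hj₀⟩]

/-- Shift the duals until an edge of slack `0` leaves the tree, and let the head be its column. -/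
def advance : Cmd :=
  .seq chooseShift shiftDuals

theorem run_advance (hi : i < n) (h : HoldsTree n i s) :
    Run advance s ((n + 1) * 190) fun s' => HoldsTree n i s' ∧ HoldsHead n s' := by
  refine Run.mono (K := (n + 1) * 70 + (n + 2) * 60) ((run_chooseShift h.size).seq
    fun s₁ hF₁ ⟨hleast, hδ⟩ => ?_) (by omega) fun _ _ h => h
  have htree : HoldsTree n i s₁ := h.of_frame hF₁ rfl rfl
  obtain ⟨hhead, hrank⟩ := hleast.head_mem (htree.exists_rank_eq_zero hi)
  refine (run_shiftDuals htree.size fun k hk k' hk' hkr => htree.matching.inj_of_root hi htree.root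
    k hk k' hk' (htree.tree.matched k hk hkr)).mono le_rfl fun s' hF₂ hs => ⟨?_, ?_, ?_, ?_⟩
  · refine htree.shift hi hF₂ hs ?_ fun j hj hj₀ => ?_
    · rw [hδ]
      exact htree.tree.minv_nonneg htree.matching hhead hrank
    · rw [hδ]
      exact (hleast.2 j hj hj₀).2
  · rwa [hF₂.ivar headVar rfl]
  · rwa [hF₂.ivar headVar rfl, hF₂.iarr rankArr rfl]
  · rw [hF₂.ivar headVar rfl, hs.minSlack, if_pos ⟨by omega, hrank⟩, hδ, sub_self]

/-- Match each column on the tree path from the head to the root to the row of its parent. -/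
def flipPath : Cmd :=
  .loop (.not (.ile (.var sizeVar) (.var headVar)))
    (.seq (.iput mateArr (.const 0) (.var headVar)
        (ivec mateArr (ivec parentArr (.var headVar))))
      (.iset headVar (ivec parentArr (.var headVar))))

theorem run_flipPath {c : ℕ → ℕ → ℝ} (hn : s.ivar sizeVar = n) (hc : ∀ r < n, ∀ j < n, 0 ≤ c r j)
    (h : IsAugmenting n i c (s.iarr parentArr 0) (s.iarr rankArr 0) (s.iarr mateArr 0)
      (s.ivar headVar)) :
    Run flipPath s ((s.iarr rankArr 0 (s.ivar headVar) + 1) * 40) fun s' =>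
      IsTightMatching n i c (s'.iarr mateArr 0) := by
  refine ((Run.loop (K := 20) (fun s' => IsAugmenting n i c (s.iarr parentArr 0) (s.iarr rankArr 0)
    (s'.iarr mateArr 0) (s'.ivar headVar)) (fun s' => s.iarr rankArr 0 (s'.ivar headVar)) h
    fun s' hF hInv hlt => ?_).mono (Nat.mul_le_mul_left _ (by decide)) fun s' hF ⟨hInv, hge⟩ => ?_)
  · simp only [BExpr.holds, IExpr.eval, (hF.ivar sizeVar rfl).trans hn, not_le] at hlt
    have hparent := hF.iarr parentArr rfl
    refine Run.of_result rfl (by decide) ?_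
    convert hInv.step hlt using 2
    · ext j
      simp [Cmd.result, IExpr.eval, hparent, Function.update_apply]
    · simp [Cmd.result, IExpr.eval, hparent]
    · simp [Cmd.result, IExpr.eval, hparent]
  · simp only [BExpr.holds, IExpr.eval, (hF.ivar sizeVar rfl).trans hn, not_not] at hge
    rw [hInv.head_le.antisymm hge] at hInv
    exact hInv.isTightMatching hc

/-- Grow the tree until the head is free, so that the matching can be augmented. -/
def growTree : Cmd :=
  .loop (.not (.ile (.var sizeVar) (ivec mateArr (.var headVar)))) (.seq absorb advance)

theorem run_growTree (hi : i < n) (h : HoldsTree n i s) (hh : HoldsHead n s) :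
    Run growTree s ((n + 1) * ((n + 1) * 300)) fun s' => HoldsTree n i s' ∧ HoldsHead n s' ∧
      s'.iarr mateArr 0 (s'.ivar headVar) = n := by
  refine ((Run.loop (K := (n + 1) * 100 + (n + 1) * 190)
    (fun s => HoldsTree n i s ∧ HoldsHead n s) (fun s => n - s.ivar countVar) ⟨h, hh⟩
    fun s₁ _ ⟨htree, hhead⟩ hlt => ?_).mono
    (Nat.mul_le_mul (by omega) (by simp only [BExpr.cost, IExpr.cost]; omega))
    fun s' _ ⟨⟨htree, hhead⟩, hge⟩ => ⟨htree, hhead, ?_⟩)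
  · simp only [BExpr.holds, IExpr.eval, htree.size, not_le] at hlt
    refine (run_absorb htree hhead hlt).seq fun s₂ _ ⟨htree₂, _⟩ =>
      (run_advance hi htree₂).mono le_rfl fun s₃ hF₃ h₃ => ⟨h₃, ?_⟩
    have hcount₃ := hF₃.ivar countVar rfl
    have := h₃.1.tree.cnt_le h₃.2.head_lt h₃.2.rank_eq
    omega
  · simp only [BExpr.holds, IExpr.eval, htree.size, not_not] at hge
    have := htree.matching.range _ hhead.head_lt
    omega

/-- Match the row of the root by flipping the tree path to the free head; giving the head a rank
marks it as the end of that path. -/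
def augment : Cmd :=
  .seq (.iput rankArr (.const 0) (.var headVar) (.add (.var countVar) (.const 1))) flipPath

theorem run_augment (hi : i < n) (h : HoldsTree n i s) (hh : HoldsHead n s)
    (hfree : s.iarr mateArr 0 (s.ivar headVar) = n) :
    Run augment s ((n + 3) * 40) (HoldsMatching n (i + 1)) := by
  have hmark : Run (.iput rankArr (.const 0) (.var headVar) (.add (.var countVar) (.const 1))) s 6
      fun s' => s'.iarr rankArr 0 =
        Function.update (s.iarr rankArr 0) (s.ivar headVar) (s.ivar countVar + 1) :=
    Run.of_result rfl (by decide) (by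
      ext
      simp [Cmd.result, IExpr.eval, Function.update_apply])
  have haug := h.tree.isAugmenting h.matching hi h.root hh.head_lt hh.rank_eq hh.minSlack_eq hfree
  have hcount := h.tree.cnt_le hh.head_lt hh.rank_eq
  refine Run.mono (K := 6 + (n + 2) * 40) (hmark.seq fun s₁ hF₁ hrank => ?_) (by omega)
    fun _ _ h => h
  have hsize := (hF₁.ivar sizeVar rfl).trans h.size
  have hrank_head : s₁.iarr rankArr 0 (s₁.ivar headVar) = s.ivar countVar + 1 := by
    rw [hrank, hF₁.ivar headVar rfl, Function.update_self]
  rw [← hrank, ← hF₁.iarr mateArr rfl, ← hF₁.iarr parentArr rfl, ← hF₁.ivar headVar rfl] at haug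
  refine (run_flipPath hsize h.matching.nonneg haug).mono (by rw [hrank_head]; omega)
    fun s' hF₂ hmatching => ⟨(hF₂.ivar sizeVar rfl).trans hsize, ?_⟩
  rwa [slackMatrix_eq_of_frame hF₂ rfl, slackMatrix_eq_of_frame hF₁ rfl]

/-- Extend the matching by the row in `rowVar`. -/
def insertRow : Cmd :=
  .seq plantTree (.seq advance (.seq growTree augment))

theorem run_insertRow (hi : i < n) (hrow : s.ivar rowVar = i) (h : HoldsMatching n i s) :
    Run insertRow s ((n + 1) * ((n + 1) * 700)) (HoldsMatching n (i + 1)) := by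
  refine Run.mono (K := (n + 1) * 60 + ((n + 1) * 190 + ((n + 1) * ((n + 1) * 300) + (n + 3) * 40)))
    ?_ (by nlinarith) fun _ _ h => h
  exact (run_plantTree hi hrow h).seq fun s₁ _ htree => (run_advance hi htree).seq
    fun s₂ _ ⟨htree, hhead⟩ => (run_growTree hi htree hhead).seq
    fun s₃ _ ⟨htree, hhead, hfree⟩ => run_augment hi htree hhead hfree

/-- Start from the column duals `0` and the empty matching. -/
def resetMatching : Cmd :=
  forLoop colVar (.var sizeVar)
    (.seq (.rput colDualArr (.const 0) (.var colVar) (.ofNat (.const 0)))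
      (.iput mateArr (.const 0) (.var colVar) (.var sizeVar)))

theorem run_resetMatching (hn : s.ivar sizeVar = n)
    (hdual : ∀ r < n, ∀ j < n, s.rarr weightArr r j ≤ s.rarr rowDualArr 0 r) :
    Run resetMatching s ((n + 1) * 30) (HoldsMatching n 0) := by
  refine Run.mono (Run.forLoop_of_loopFree (fun m s' => ∀ j < m, s'.rarr colDualArr 0 j = 0 ∧
    s'.iarr mateArr 0 j = n) rfl rfl (fun s' hF => (hF.ivar sizeVar rfl).trans hn) (by simp) ?_
    (by decide)) le_rfl fun s' hF hreset => ⟨(hF.ivar sizeVar rfl).trans hn, ?_⟩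
  · intro m _ s' hF hj hInv j hjm
    have hsize := (hF.ivar sizeVar rfl).trans hn
    have hold := hInv j
    simp only [Cmd.result, IExpr.eval, RExpr.eval, hj, State.putR_ivar, hsize]
    grind
  · refine .empty (fun r hr j hj => ?_) fun j hj => (hreset j hj).2
    rw [slackMatrix, (hreset j hj).1, hF.rarr rowDualArr rfl, hF.rarr weightArr rfl, add_zero]
    exact sub_nonneg.2 (hdual r hr j hj)

/-- The Hungarian method, started from row duals that dominate the rows of the weight matrix. -/
def hungarian : Cmd :=
  .seq resetMatching (forLoop rowVar (.var sizeVar) insertRow)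

theorem run_hungarian (hn : s.ivar sizeVar = n)
    (hdual : ∀ r < n, ∀ j < n, s.rarr weightArr r j ≤ s.rarr rowDualArr 0 r) :
    Run hungarian s ((n + 1) * ((n + 1) * ((n + 1) * 800))) (HoldsMatching n n) := by
  refine Run.mono (K := (n + 1) * 30 + (n + 1) * ((n + 1) * ((n + 1) * 700) + 1 + 10))
    ((run_resetMatching hn hdual).seq fun s₁ _ hempty => ?_) (by ring_nf; omega) fun _ _ h => h
  exact Run.forLoop (HoldsMatching n) rfl (fun s' hF => (hF.ivar sizeVar rfl).trans hempty.size)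
    ⟨hempty.size, hempty.matching⟩ fun i hi s' _ hrow hInv =>
    (run_insertRow hi hrow hInv).mono le_rfl fun s'' _ h => ⟨h.size, h.matching⟩

/-! ### A program for one iteration -/

variable {t : ℕ} {κ : ℝ} {u : Fin n → Fin n → ℝ} {x : Alloc n}

theorem Stores.of_frame {c : Cmd} {s' : State} (h : Stores s t κ u x) (hF : Frame c s s')
    (hc : [Loc.ivar sizeVar, .ivar stepVar, .rvar kappaVar, .rarr utilArr, .rarr iterArr].all
      c.keeps = true) : Stores s' t κ u x := by
  simp only [List.all_cons, List.all_nil, Bool.and_true, Bool.and_eq_true] at hc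
  obtain ⟨hsize, hstep, hkappa, hutil, hiter⟩ := hc
  rw [Stores, hF.ivar _ hsize, hF.ivar _ hstep, hF.rvar _ hkappa, hF.rarr _ hutil, hF.rarr _ hiter]
  exact h

/-- Compute the utility of the agent in `rowVar`. -/
def rowUtility : Cmd :=
  .seq (.rset utilityVar (.ofNat (.const 0)))
    (forLoop colVar (.var sizeVar) (.rset utilityVar (.add (.var utilityVar)
      (.mul (.get utilArr (.var rowVar) (.var colVar))
        (.get iterArr (.var rowVar) (.var colVar))))))

theorem run_rowUtility (hs : Stores s t κ u x) (i : Fin n) (hrow : s.ivar rowVar = i) :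
    Run rowUtility s ((n + 1) * 50) fun s' => s'.rvar utilityVar = utility u x i := by
  have hreset : Run (.rset utilityVar (.ofNat (.const 0))) s 5 fun s' => s'.rvar utilityVar = 0 :=
    Run.of_result rfl (by decide) (by simp [Cmd.result, RExpr.eval, IExpr.eval])
  have hutility : ∑ j ∈ Finset.range n, s.rarr utilArr i j * s.rarr iterArr i j =
      utility u x i := by
    rw [Finset.sum_range, utility]
    exact Finset.sum_congr rfl fun j _ => congrArg₂ _ (hs.2.2.2.1 i j) (hs.2.2.2.2 i j)
  refine Run.mono (K := 5 + (n + 1) * 40) (hreset.seq fun s₁ hF₁ hzero => Run.mono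
    (Run.forLoop_of_loopFree (fun m s' => s'.rvar utilityVar =
      ∑ j ∈ Finset.range m, s.rarr utilArr i j * s.rarr iterArr i j) rfl rfl
      (fun s' hF => (hF.ivar sizeVar rfl).trans ((hF₁.ivar sizeVar rfl).trans hs.1))
      (by simp [hzero]) ?_ (by decide)) le_rfl fun s' _ hsum => hsum.trans hutility)
    (by omega) fun _ _ h => h
  intro m _ s' hF hj hInv
  rw [Finset.sum_range_succ, ← hInv]
  simp [Cmd.result, RExpr.eval, IExpr.eval, hj, hF.ivar rowVar rfl, hF₁.ivar rowVar rfl, hrow,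
    hF.rarr utilArr rfl, hF₁.rarr utilArr rfl, hF.rarr iterArr rfl, hF₁.rarr iterArr rfl]

/-- Let the dual of the row in `rowVar` be the derivative of the utility term of that agent. -/
def rowMarginal : Cmd :=
  .ite (.rle (.var utilityVar) (.var thresholdVar))
    (.rput rowDualArr (.const 0) (.var rowVar)
      (.sub (.div (.ofNat (.const 2)) (.var thresholdVar))
        (.div (.var utilityVar) (.mul (.var thresholdVar) (.var thresholdVar)))))
    (.rput rowDualArr (.const 0) (.var rowVar) (.div (.ofNat (.const 1)) (.var utilityVar)))

theorem run_rowMarginal (s : State) :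
    Run rowMarginal s 40 fun s' => ∀ r, s'.rarr rowDualArr 0 r =
      if r = s.ivar rowVar then etaDeriv (s.rvar utilityVar) (s.rvar thresholdVar)
      else s.rarr rowDualArr 0 r := by
  refine Run.of_result rfl (by decide) fun r => ?_
  simp only [rowMarginal, Cmd.result, BExpr.holds, RExpr.eval, IExpr.eval, etaDeriv, sq]
  by_cases hle : s.rvar utilityVar ≤ s.rvar thresholdVar <;> simp [hle]

/-- Compute the weights in the row in `rowVar`. -/
def rowWeights : Cmd :=
  forLoop colVar (.var sizeVar) (.rput weightArr (.var rowVar) (.var colVar)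
    (.mul (rvec rowDualArr (.var rowVar)) (.get utilArr (.var rowVar) (.var colVar))))

theorem run_rowWeights (hn : s.ivar sizeVar = n) :
    Run rowWeights s ((n + 1) * 50) fun s' => ∀ r, ∀ j < n, s'.rarr weightArr r j =
      if r = s.ivar rowVar then s.rarr rowDualArr 0 r * s.rarr utilArr r j
      else s.rarr weightArr r j := by
  refine Run.mono (Run.forLoop_of_loopFree (m := n) (fun m s' => ∀ r j, s'.rarr weightArr r j =
      if r = s.ivar rowVar ∧ j < m then s.rarr rowDualArr 0 r * s.rarr utilArr r j
      else s.rarr weightArr r j) rfl rfl (fun s' hF => (hF.ivar sizeVar rfl).trans hn) (by simp) ?_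
      (by decide)) le_rfl fun s' _ h r j hj => by simpa [hj] using h r j
  intro m _ s' hF hj hInv r j
  have hold := hInv r j
  simp only [Cmd.result, RExpr.eval, IExpr.eval, hj, hF.ivar rowVar rfl, hF.rarr utilArr rfl,
    hF.rarr rowDualArr rfl]
  grind

/-- The memory holds the gradient of `ψ` in the row `i` of the weights and, as the dual of that row,
the factor that turns the utilities of the agent `i` into this gradient. -/
def HoldsGradient (κ : ℝ) (u : Fin n → Fin n → ℝ) (x : Alloc n) (i : Fin n) (s : State) : Prop :=
  s.rarr rowDualArr 0 i = etaDeriv (utility u x i) (threshold n κ) ∧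
    ∀ j : Fin n, s.rarr weightArr i j = gradPsi κ u x i j

/-- Compute the gradient in the row in `rowVar`. -/
def rowGradient : Cmd :=
  .seq rowUtility (.seq rowMarginal rowWeights)

theorem run_rowGradient (hz₀ : 0 < threshold n κ) (hs : Stores s t κ u x)
    (hthreshold : s.rvar thresholdVar = threshold n κ) (i : Fin n) (hrow : s.ivar rowVar = i) :
    Run rowGradient s ((n + 1) * 140) fun s' => HoldsGradient κ u x i s' ∧
      ∀ k ≠ i, HoldsGradient κ u x k s → HoldsGradient κ u x k s' := by
  refine Run.mono (K := (n + 1) * 50 + (40 + (n + 1) * 50)) ((run_rowUtility hs i hrow).seq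
    fun s₁ hF₁ hutility => (run_rowMarginal s₁).seq fun s₂ hF₂ hdual => ?_) (by omega)
    fun _ _ h => h
  have hs₂ : Stores s₂ t κ u x := (hs.of_frame hF₁ rfl).of_frame hF₂ rfl
  have hrow₁ := (hF₁.ivar rowVar rfl).trans hrow
  have hrow₂ := (hF₂.ivar rowVar rfl).trans hrow₁
  rw [hrow₁, hutility, (hF₁.rvar thresholdVar rfl).trans hthreshold,
    hF₁.rarr rowDualArr rfl] at hdual
  refine (run_rowWeights hs₂.1).mono le_rfl fun s' hF₃ hweight => ⟨⟨?_, fun j => ?_⟩,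
    fun k hk hold => ⟨?_, fun j => ?_⟩⟩
  · rw [hF₃.rarr rowDualArr rfl, hdual, if_pos rfl]
  · rw [hweight i j j.2, hrow₂, if_pos rfl, hdual, if_pos rfl, hs₂.2.2.2.1, gradPsi_eq hz₀]
  · rw [hF₃.rarr rowDualArr rfl, hdual, if_neg (Fin.val_ne_of_ne hk), hold.1]
  · rw [hweight k j j.2, hrow₂, if_neg (Fin.val_ne_of_ne hk), hF₂.rarr weightArr rfl,
      hF₁.rarr weightArr rfl, hold.2]

/-- Compute the gradient of `ψ` at the iterate. -/
def computeGradient : Cmd :=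
  .seq (.rset thresholdVar (.div (.ofNat (.const 1))
      (.mul (.mul (.ofNat (.const 2)) (.var kappaVar)) (.ofNat (.var sizeVar)))))
    (forLoop rowVar (.var sizeVar) rowGradient)

theorem run_computeGradient (hz₀ : 0 < threshold n κ) (hs : Stores s t κ u x) :
    Run computeGradient s ((n + 1) * ((n + 1) * 170)) fun s' => ∀ i, HoldsGradient κ u x i s' := by
  have hthreshold : Run (.rset thresholdVar (.div (.ofNat (.const 1))
      (.mul (.mul (.ofNat (.const 2)) (.var kappaVar)) (.ofNat (.var sizeVar))))) s 15
      fun s' => s'.rvar thresholdVar = threshold n κ :=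
    Run.of_result rfl (by decide) (by simp [Cmd.result, RExpr.eval, IExpr.eval, hs.1, hs.2.2.1])
  refine Run.mono (K := 15 + (n + 1) * ((n + 1) * 140 + 1 + 10)) (hthreshold.seq fun s₁ hF₁ hz =>
    Run.mono (Run.forLoop (fun m s' => ∀ i : Fin n, i < m → HoldsGradient κ u x i s') rfl
      (fun s' hF => (hF.ivar sizeVar rfl).trans ((hF₁.ivar sizeVar rfl).trans hs.1)) (by simp) ?_)
      le_rfl fun s' _ h i => h i i.2) (by ring_nf; omega) fun _ _ h => h
  intro m hm s₂ hF₂ hrow hInv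
  have hs₂ : Stores s₂ t κ u x := (hs.of_frame hF₁ rfl).of_frame hF₂ rfl
  refine (run_rowGradient hz₀ hs₂ ((hF₂.rvar thresholdVar rfl).trans hz) ⟨m, hm⟩ hrow).mono le_rfl
    fun s' _ ⟨hnew, hold⟩ i hi => ?_
  rcases Nat.lt_succ_iff_lt_or_eq.1 hi with hlt | heq
  · exact hold i (Fin.ne_of_lt hlt) (hInv i hlt)
  · exact (Fin.ext heq : i = ⟨m, hm⟩) ▸ hnew

/-- Move the entry of the iterate in `rowVar` and `colVar` towards the matching; the step size is
in `shiftVar`. -/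
def moveEntry : Cmd :=
  .ite (.and (.ile (ivec mateArr (.var colVar)) (.var rowVar))
      (.ile (.var rowVar) (ivec mateArr (.var colVar))))
    (.rput iterArr (.var rowVar) (.var colVar)
      (.add (.mul (.sub (.ofNat (.const 1)) (.var shiftVar))
        (.get iterArr (.var rowVar) (.var colVar))) (.var shiftVar)))
    (.rput iterArr (.var rowVar) (.var colVar) (.mul (.sub (.ofNat (.const 1)) (.var shiftVar))
      (.get iterArr (.var rowVar) (.var colVar))))

/-- The value that `moveEntry` assigns to the entry `r`, `j` of the iterate. -/
noncomputable def movedEntry (s : State) (r j : ℕ) : ℝ :=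
  (1 - s.rvar shiftVar) * s.rarr iterArr r j +
    if s.iarr mateArr 0 j = r then s.rvar shiftVar else 0

/-- Move the row of the iterate in `rowVar` towards the matching. -/
def moveRow : Cmd :=
  forLoop colVar (.var sizeVar) moveEntry

theorem run_moveRow (hn : s.ivar sizeVar = n) :
    Run moveRow s ((n + 1) * 60) fun s' => ∀ r, ∀ j < n, s'.rarr iterArr r j =
      if r = s.ivar rowVar then movedEntry s r j else s.rarr iterArr r j := by
  refine Run.mono (Run.forLoop_of_loopFree (m := n) (fun m s' => ∀ r j, s'.rarr iterArr r j =
      if r = s.ivar rowVar ∧ j < m then movedEntry s r j else s.rarr iterArr r j) rfl rfl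
      (fun s' hF => (hF.ivar sizeVar rfl).trans hn) (by simp) ?_ (by decide)) le_rfl
    fun s' _ h r j hj => by simpa [hj] using h r j
  intro m _ s' hF hj hInv r j
  have hold := hInv r j
  simp only [moveEntry, Cmd.result, BExpr.holds, RExpr.eval, IExpr.eval, hj, hF.ivar rowVar rfl,
    hF.rvar shiftVar rfl, hF.iarr mateArr rfl, movedEntry, ← le_antisymm_iff] at hold ⊢
  split_ifs <;> grind

/-- Move the iterate towards the matching. -/
def moveIterate : Cmd :=
  forLoop rowVar (.var sizeVar) moveRow

theorem run_moveIterate (hn : s.ivar sizeVar = n) :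
    Run moveIterate s ((n + 1) * ((n + 1) * 80)) fun s' =>
      ∀ r < n, ∀ j < n, s'.rarr iterArr r j = movedEntry s r j := by
  refine Run.mono (K := (n + 1) * ((n + 1) * 60 + 1 + 10)) (Run.forLoop (fun m s' => ∀ r, ∀ j < n,
    s'.rarr iterArr r j = if r < m then movedEntry s r j else s.rarr iterArr r j) rfl
    (fun s' hF => (hF.ivar sizeVar rfl).trans hn) (by simp) fun m _ s₁ hF₁ hrow hInv => ?_)
    (Nat.mul_le_mul_left _ (by omega)) fun s' _ h r hr j hj => (h r j hj).trans (if_pos hr)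
  refine (run_moveRow ((hF₁.ivar sizeVar rfl).trans hn)).mono le_rfl fun s' _ h r j hj => ?_
  have hnew := h r j hj
  have hold := hInv r j hj
  simp only [movedEntry, hrow, hF₁.rvar shiftVar rfl, hF₁.iarr mateArr rfl] at hnew hold ⊢
  grind

/-- One update of the conditional gradient algorithm, from a matching in the memory. -/
def updateIterate : Cmd :=
  .seq (.rset shiftVar (.div (.ofNat (.const 2))
      (.add (.ofNat (.var stepVar)) (.ofNat (.const 1)))))
    (.seq moveIterate (.iset stepVar (.add (.var stepVar) (.const 1))))

theorem run_updateIterate (hs : Stores s t κ u x) {σ : Equiv.Perm (Fin n)}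
    (hσ : ∀ i j : Fin n, s.iarr mateArr 0 j = i ↔ σ i = j) :
    Run updateIterate s ((n + 1) * ((n + 1) * 100)) fun s' => Stores s' (t + 1) κ u
      ((1 - 2 / ((t : ℝ) + 1)) • x + (2 / ((t : ℝ) + 1)) • permAlloc σ) := by
  have hstep : Run (.rset shiftVar (.div (.ofNat (.const 2))
      (.add (.ofNat (.var stepVar)) (.ofNat (.const 1))))) s 10 fun s' =>
      s'.rvar shiftVar = 2 / ((t : ℝ) + 1) :=
    Run.of_result rfl (by decide) (by simp [Cmd.result, RExpr.eval, IExpr.eval, hs.2.1])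
  refine Run.mono (K := 10 + ((n + 1) * ((n + 1) * 80) + 5)) (hstep.seq fun s₁ hF₁ hshift =>
    (run_moveIterate ((hF₁.ivar sizeVar rfl).trans hs.1)).seq fun s₂ hF₂ hmove =>
    Run.of_result rfl (by decide) ?_) (by ring_nf; omega) fun _ _ h => h
  obtain ⟨hsize, hstep, hkappa, hutil, hiter⟩ := hs
  refine ⟨?_, ?_, ?_, fun i j => ?_, fun i j => ?_⟩
  · simp [hF₂.ivar sizeVar rfl, hF₁.ivar sizeVar rfl, hsize]
  · simp [hF₂.ivar stepVar rfl, hF₁.ivar stepVar rfl, hstep]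
  · simp [hF₂.rvar kappaVar rfl, hF₁.rvar kappaVar rfl, hkappa]
  · simp [hF₂.rarr utilArr rfl, hF₁.rarr utilArr rfl, hutil]
  · simp [hmove i i.2 j j.2, movedEntry, hshift, hF₁.rarr iterArr rfl, hF₁.iarr mateArr rfl, hiter,
      hσ, permAlloc]

/-- One iteration of the conditional gradient algorithm. -/
def iteration : Cmd :=
  .seq computeGradient (.seq hungarian updateIterate)

theorem HoldsMatching.exists_isMaxWeightMatching {w : Fin n → Fin n → ℝ} (h : HoldsMatching n n s)
    (hw : 0 ≤ w) (hweight : ∀ i j : Fin n, s.rarr weightArr i j = w i j) :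
    ∃ σ : Equiv.Perm (Fin n), (∀ i j : Fin n, s.iarr mateArr 0 j = i ↔ σ i = j) ∧
      IsMaxWeightMatching w (permAlloc σ) := by
  obtain ⟨σ, hσ⟩ := h.matching.exists_perm
  refine ⟨σ, hσ, isMaxWeightMatching_of_dual hw (fun i => s.rarr rowDualArr 0 i)
    (fun j => s.rarr colDualArr 0 j) (fun i j => ?_) σ fun i => ?_⟩
  · rw [← hweight]
    exact sub_nonneg.1 (h.matching.nonneg i i.2 j j.2)
  · have hmate := (hσ i (σ i)).2 rfl
    have htight := h.matching.tight (σ i) (σ i).2 (hmate.trans_lt i.2)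
    rw [hmate] at htight
    rw [← hweight]
    exact (sub_eq_zero.1 htight).symm

theorem run_iteration (hκ : 0 < κ) (hn : 0 < n) (hu : u ∈ Set.Icc 0 1) (hs : Stores s t κ u x) :
    Run iteration s (20000 * n ^ 3) fun s' =>
      ∃ x' : Alloc n, IsStep κ u t x x' ∧ Stores s' (t + 1) κ u x' := by
  have hz₀ := threshold_pos hκ hn
  refine Run.mono (K := (n + 1) * ((n + 1) * 170) +
    ((n + 1) * ((n + 1) * ((n + 1) * 800)) + (n + 1) * ((n + 1) * 100)))
    ((run_computeGradient hz₀ hs).seq fun s₁ hF₁ hgrad =>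
      (run_hungarian ((hF₁.ivar sizeVar rfl).trans hs.1) ?_).seq fun s₂ hF₂ hmatching => ?_) ?_
    fun _ _ h => h
  · intro r hr j hj
    obtain ⟨hdual, hweight⟩ := hgrad ⟨r, hr⟩
    rw [hdual, hweight ⟨j, hj⟩, gradPsi_eq hz₀]
    exact mul_le_of_le_one_right (etaDeriv_nonneg hz₀ _) (hu.2 _ _)
  · obtain ⟨σ, hσ, hmax⟩ := hmatching.exists_isMaxWeightMatching (gradPsi_nonneg hz₀ hu.1 x)
      fun i j => by rw [hF₂.rarr weightArr rfl, (hgrad i).2 j]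
    exact (run_updateIterate ((hs.of_frame hF₁ rfl).of_frame hF₂ rfl) hσ).mono le_rfl
      fun s' _ hstores => ⟨_, ⟨_, hmax, rfl⟩, hstores⟩
  · calc (n + 1) * ((n + 1) * 170) +
          ((n + 1) * ((n + 1) * ((n + 1) * 800)) + (n + 1) * ((n + 1) * 100))
        ≤ 2500 * (n + 1) ^ 3 := by ring_nf; omega
      _ ≤ 2500 * (2 * n) ^ 3 := by gcongr; omega
      _ = 20000 * n ^ 3 := by ring

theorem IsInstance.mem_Icc (h : IsInstance κ u) : u ∈ Set.Icc 0 1 :=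
  ⟨h.nonneg, fun i j => (h.max_eq_one i).2 ⟨j, rfl⟩⟩

end LiF

theorem mainTheorem2_general :
    (∃ C : ℝ, 0 < C ∧ ∀ (n : ℕ) (κ : ℝ) (u : Fin n → Fin n → ℝ), 0 < n → 0 < κ →
      u ∈ Set.Icc 0 1 →
      (∃ xstar : LiF.Alloc n, LiF.IsOptimal κ u xstar) ∧
      ∀ xstar : LiF.Alloc n, LiF.IsOptimal κ u xstar →
        ∀ ε : ℝ, 0 < ε → ∀ T : ℕ, C * ((n : ℝ) ^ 3 * κ ^ 2 / ε) ≤ (T : ℝ) →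
          ∀ x : ℕ → LiF.Alloc n, LiF.IsRun κ u T x →
            x T ∈ LiF.matchingPolytope n ∧ LiF.psi κ u xstar - LiF.psi κ u (x T) ≤ ε) ∧
    (∃ (iteration : RealRAM.Cmd) (C : ℕ), ∀ (n : ℕ) (κ : ℝ) (u : Fin n → Fin n → ℝ), 0 < n →
      0 < κ → u ∈ Set.Icc 0 1 →
      ∀ (t : ℕ) (x : LiF.Alloc n) (s : RealRAM.State), LiF.Stores s t κ u x →
        ∃ (s' : RealRAM.State) (x' : LiF.Alloc n) (k : ℕ),
          RealRAM.Exec iteration s s' k ∧ k ≤ C * n ^ 3 ∧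
            LiF.IsStep κ u t x x' ∧ LiF.Stores s' (t + 1) κ u x') := by
  refine ⟨⟨8, by norm_num, fun n κ u hn hκ hu => ⟨LiF.exists_isOptimal (LiF.threshold_pos hκ hn) u,
    fun xstar hopt ε hε T hT x hrun => hrun.mem_and_gap_le hκ hn hu hopt.1 hε hT⟩⟩,
    LiF.iteration, 20000, fun n κ u hn hκ hu t x s hs => ?_⟩
  obtain ⟨s', k, hexec, hcost, x', hstep, hstores⟩ := LiF.run_iteration hκ hn hu hs
  exact ⟨s', x', k, hexec, hcost, hstep, hstores⟩

theorem mainTheorem2 :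
    (∃ C : ℝ, 0 < C ∧ ∀ (n : ℕ) (κ : ℝ) (u : Fin n → Fin n → ℝ), 0 < n → LiF.IsInstance κ u →
      (∃ xstar : LiF.Alloc n, LiF.IsOptimal κ u xstar) ∧
      ∀ xstar : LiF.Alloc n, LiF.IsOptimal κ u xstar →
        ∀ ε : ℝ, 0 < ε → ∀ T : ℕ, C * ((n : ℝ) ^ 3 * κ ^ 2 / ε) ≤ (T : ℝ) →
          ∀ x : ℕ → LiF.Alloc n, LiF.IsRun κ u T x →
            x T ∈ LiF.matchingPolytope n ∧ LiF.psi κ u xstar - LiF.psi κ u (x T) ≤ ε) ∧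
    (∃ (iteration : RealRAM.Cmd) (C : ℕ), ∀ (n : ℕ) (κ : ℝ) (u : Fin n → Fin n → ℝ), 0 < n →
      LiF.IsInstance κ u →
      ∀ (t : ℕ) (x : LiF.Alloc n), 1 ≤ t → x ∈ LiF.matchingPolytope n →
        ∀ s : RealRAM.State, LiF.Stores s t κ u x →
          ∃ (s' : RealRAM.State) (x' : LiF.Alloc n) (k : ℕ),
            RealRAM.Exec iteration s s' k ∧ k ≤ C * n ^ 3 ∧
              LiF.IsStep κ u t x x' ∧ LiF.Stores s' (t + 1) κ u x') :=
  let ⟨⟨C, hC, hconv⟩, iteration, K, hcost⟩ := mainTheorem2_general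
  ⟨⟨C, hC, fun n κ u hn h => hconv n κ u hn h.kappa_pos h.mem_Icc⟩, iteration, K,
    fun n κ u hn h t x _ _ s hs => hcost n κ u hn h.kappa_pos h.mem_Icc t x s hs⟩
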